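/- Let $\mathcal R$ be the $N=1$ Ramond algebra extended by the fermion parity operator, i.e. its enveloping algebra $U(\mathcal R)$ is the associative $\mathbb C$-algebra generated by $L_m,G_m$ ($m\in\mathbb Z$), $C$ and $(-1)^F$ with the relations $$[L_m,L_n]=(m-n)L_{m+n}+\tfrac{C}{12}(m^3-m)\delta_{m+n,0},\qquad [L_m,G_n]=(\tfrac m2-n)G_{m+n},$$ $$\{G_m,G_n\}=2L_{m+n}+\tfrac C3(m^2-\tfrac14)\delta_{m+n,0},$$ where $C$ commutes with every generator, and $(-1)^F$ commutes with $L_m$ and anticommutes with $G_m$. For $c,\Delta\in\mathbb C$ let $\mathcal V_\Delta$ be the Verma module of central charge $c$ generated by a highest weight vector $|\Delta\rangle$ with $L_m|\Delta\rangle=G_m|\Delta\rangle=0$ for $m\ge1$, $L_0|\Delta\rangle=\Delta|\Delta\rangle$, $C|\Delta\rangle=c|\Delta\rangle$, $(-1)^F|\Delta\rangle=|\Delta\rangle$. The standard monomials are $$X=L_{-m_k}\cdots L_{-m_1}G_{-n_j}\cdots G_{-n_1}L_{-1}^nG_{-1}^{r_1}G_0^{r_2},\quad m_k\ge\dots\ge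 m_1\ge2,\ n_j>\dots>n_1\ge2,\ n\ge0,\ r_1,r_2\in\{0,1\},$$ of level $\sum m_i+\sum n_i+n+r_1$ and parity $(-1)^{j+r_1+r_2}$. A vector satisfies the highest weight conditions at level $l\in\{0,1,2,\dots\}$ and parity $\pm$ if $L_0$, $C$ and $(-1)^F$ act on it as the scalars $\Delta+l$, $c$ and $\pm1$, and it is annihilated by all $L_m,G_m$ with $m\ge1$; it is singular if moreover it is not proportional to $|\Delta\rangle$, and $G$-closed if it is annihilated by $G_0$. A normal form of a vector of level $l$ and parity $\pm$ is an expression of it as $\theta|\Delta\rangle$, where $\theta\in U(\mathcal R)$ is a finite linear combination of standard monomials of that level and parity. The vector, and $\theta$, are said to be given by $(a,b)^\pm_l$ if the vector satisfies the highest weight conditions at level $l$ and parity $\pm$, has a unique normal form $\theta|\Delta\rangle$, and $$\theta=aL_{-1}^l+bL_{-1}^{l-1}G_{-1}G_0+\cdots\ \ (\text{parity }+),\qquad \theta=aL_{-1}^lG_0+bL_{-1}^{l-1}G_{-1}+\cdots\ \ (\text{parity }-),$$ with the convention $b=0$ for $l=0$. **Theorem.** Let $c,\Delta\in\mathbb C$.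 (0) Every singular vector in $\mathcal V_\Delta$ of level $l$ and parity $\pm$ has exactly one normal form $\theta|\Delta\rangle$. (1) If a singular vector $\theta|\Delta\rangle$, with $\theta$ in normal form, is given by $(a,b)^+_l$, then $G_0\theta|\Delta\rangle$ and $\theta G_0|\Delta\rangle$ are given by $$\bigl(a+2b,\,-b[\Delta-\tfrac c{24}]+\tfrac12la\bigr)^-_l\quad\text{and}\quad\bigl(a,\,b[\Delta-\tfrac c{24}]\bigr)^-_l,$$ respectively. If a singular vector $\theta|\Delta\rangle$ is given by $(a,b)^-_l$, then $G_0\theta|\Delta\rangle$ and $\theta G_0|\Delta\rangle$ are given by $$\bigl(a[\Delta-\tfrac c{24}]+2b,\,\tfrac12la-b\bigr)^+_l\quad\text{and}\quad\bigl(a[\Delta-\tfrac c{24}],\,b\bigr)^+_l,$$ respectively. (2) Let $l\ge1$ be an integer and $\Delta=\frac c{24}-l$. A singular vector in $\mathcal V_\Delta$ (of any level $l'\ge 0$ and parity) is $G$-closed if and only if it has level $l$ and is given, for some $a\in\mathbb C$, by $(a,-\frac a2)^+_l$ if its parity is $+$, or by $(\frac2l a,a)^-_l$ if its parity is $-$.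 -/

import Mathlib

noncomputable section

namespace Ramond

/-- Generators of the (extended) `N = 1` Ramond algebra: the Virasoro modes `L m`, the fermionic
modes `G n`, the central element `C` and the fermion parity operator `F`, i.e. `(-1)^F`. -/
inductive Gen : Type
  | L (m : ℤ)
  | G (n : ℤ)
  | C
  | F

/-- Shorthand for a generator inside the free associative algebra. -/
abbrev gen (x : Gen) : FreeAlgebra ℂ Gen := FreeAlgebra.ι ℂ x

/-- The defining (super)commutation relations of the Ramond algebra. -/
inductive Rel : FreeAlgebra ℂ Gen → FreeAlgebra ℂ Gen → Prop
  | LL (m n : ℤ) : Rel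
      (gen (.L m) * gen (.L n) - gen (.L n) * gen (.L m))
      (((m : ℂ) - n) • gen (.L (m + n)) +
        (if m + n = 0 then ((m : ℂ) ^ 3 - m) / 12 else 0) • gen .C)
  | LG (m n : ℤ) : Rel
      (gen (.L m) * gen (.G n) - gen (.G n) * gen (.L m))
      (((m : ℂ) / 2 - n) • gen (.G (m + n)))
  | GG (m n : ℤ) : Rel
      (gen (.G m) * gen (.G n) + gen (.G n) * gen (.G m))
      ((2 : ℂ) • gen (.L (m + n)) +
        (if m + n = 0 then ((m : ℂ) ^ 2 - 1 / 4) / 3 else 0) • gen .C)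
  | LC (m : ℤ) : Rel (gen (.L m) * gen .C - gen .C * gen (.L m)) 0
  | GC (n : ℤ) : Rel (gen (.G n) * gen .C - gen .C * gen (.G n)) 0
  | FL (m : ℤ) : Rel (gen .F * gen (.L m) - gen (.L m) * gen .F) 0
  | FC : Rel (gen .F * gen .C - gen .C * gen .F) 0
  | FG (n : ℤ) : Rel (gen .F * gen (.G n) + gen (.G n) * gen .F) 0

/-- The universal enveloping algebra `U(R)` of the Ramond algebra. -/
abbrev U : Type := RingQuot Rel

def L (m : ℤ) : U := RingQuot.mkAlgHom ℂ Rel (gen (.L m))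
def G (n : ℤ) : U := RingQuot.mkAlgHom ℂ Rel (gen (.G n))
def C : U := RingQuot.mkAlgHom ℂ Rel (gen .C)
def F : U := RingQuot.mkAlgHom ℂ Rel (gen .F)

/-- The left ideal of `U(R)` generated by `L m`, `G m` (`m ≥ 1`), `L 0 - Δ`, `C - c` and
`(-1)^F - 1`. -/
def vermaIdeal (c Δ : ℂ) : Submodule U U :=
  Submodule.span U
    ({x | ∃ m : ℤ, 1 ≤ m ∧ (x = L m ∨ x = G m)} ∪
      {L 0 - algebraMap ℂ U Δ, C - algebraMap ℂ U c, F - 1})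

/-- The Verma module with central charge `c` and conformal weight `Δ`: the left `U(R)`-module
induced from the one-dimensional module on which `L m`, `G m` (`m ≥ 1`) act by `0`, and `L 0`, `C`,
`(-1)^F` act by `Δ`, `c`, `1`. -/
abbrev Verma (c Δ : ℂ) : Type := U ⧸ vermaIdeal c Δ

/-- The highest weight vector `|Δ⟩`. -/
def vac (c Δ : ℂ) : Verma c Δ := Submodule.Quotient.mk 1

/-- Labels of the standard monomials
`L_{-m_L} ⋯ L_{-m_1} G_{-n_G} ⋯ G_{-n_1} L_{-1}^n G_{-1}^{r₁} G_0^{r₂}` with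
`m_L ≥ ⋯ ≥ m_1 ≥ 2`, `n_G > ⋯ > n_1 ≥ 2`, `n ≥ 0` and `r₁, r₂ ∈ {0, 1}`. -/
@[ext]
structure Label : Type where
  Ls : Multiset ℕ
  Gs : Finset ℕ
  n : ℕ
  r₁ : Fin 2
  r₂ : Fin 2
  two_le_L : ∀ m ∈ Ls, 2 ≤ m
  two_le_G : ∀ m ∈ Gs, 2 ≤ m

/-- The standard monomial with a given label. -/
def Label.mono (X : Label) : U :=
  ((X.Ls.sort (· ≥ ·)).map fun m : ℕ => L (-(m : ℤ))).prod *
    ((X.Gs.sort (· ≥ ·)).map fun m : ℕ => G (-(m : ℤ))).prod *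
    L (-1) ^ X.n * G (-1) ^ (X.r₁ : ℕ) * G 0 ^ (X.r₂ : ℕ)

def Label.level (X : Label) : ℕ :=
  X.Ls.sum + ∑ m ∈ X.Gs, m + X.n + (X.r₁ : ℕ)

def Label.parity (X : Label) : ℤˣ :=
  (-1) ^ (X.Gs.card + (X.r₁ : ℕ) + (X.r₂ : ℕ))

/-- The operator `∑ κ_X X ∈ U(R)` with coefficients `κ` on the standard monomials. -/
def op (κ : Label →₀ ℂ) : U := κ.sum fun X a => a • X.mono

/-- `κ` is a normal form of `Ψ` at level `l` and parity `p`: `κ` is supported on standard monomials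
of level `l` and parity `p`, and `Ψ = ∑ κ_X X|Δ⟩`. -/
def IsNormalForm (c Δ : ℂ) (p : ℤˣ) (l : ℕ) (κ : Label →₀ ℂ) (Ψ : Verma c Δ) : Prop :=
  (∀ X ∈ κ.support, X.level = l ∧ X.parity = p) ∧ Ψ = op κ • vac c Δ

/-- The highest weight conditions at level `l` and parity `p` (the zero vector is allowed):
`Ψ` has `L 0`-, `C`- and `(-1)^F`-eigenvalues `Δ + l`, `c` and `p`, and is annihilated by all
`L m`, `G m` with `m ≥ 1`. -/
def IsHighestWeight (c Δ : ℂ) (p : ℤˣ) (l : ℕ) (Ψ : Verma c Δ) : Prop :=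
  L 0 • Ψ = (Δ + l) • Ψ ∧ C • Ψ = c • Ψ ∧ F • Ψ = (((p : ℤˣ) : ℤ) : ℂ) • Ψ ∧
    ∀ m : ℤ, 1 ≤ m → L m • Ψ = 0 ∧ G m • Ψ = 0

/-- Singular vectors of level `l` and parity `p`: the highest weight conditions hold and `Ψ` is not
proportional to `|Δ⟩` (in particular `Ψ ≠ 0`). -/
def IsSingular (c Δ : ℂ) (p : ℤˣ) (l : ℕ) (Ψ : Verma c Δ) : Prop :=
  IsHighestWeight c Δ p l Ψ ∧ Ψ ∉ Submodule.span ℂ {vac c Δ}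

/-- First kernel coefficient: of `L_{-1}^l` for parity `+`, of `L_{-1}^l G_0` for parity `-`. -/
def coeffA (p : ℤˣ) (l : ℕ) (κ : Label →₀ ℂ) : ℂ :=
  κ ⟨0, ∅, l, 0, if p = 1 then 0 else 1, by simp, by simp⟩

/-- Second kernel coefficient: of `L_{-1}^{l-1} G_{-1} G_0` for parity `+`, of
`L_{-1}^{l-1} G_{-1}` for parity `-`. At level `0` there is no such monomial, and the coefficient
is `0`. -/
def coeffB (p : ℤˣ) (l : ℕ) (κ : Label →₀ ℂ) : ℂ :=
  if l = 0 then 0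
  else κ ⟨0, ∅, l - 1, 1, if p = 1 then 1 else 0, by simp, by simp⟩

/-- `Ψ = (a, b)_l^p |Δ⟩`: `Ψ` satisfies the highest weight conditions at level `l` and parity `p`,
and it has a unique normal form, whose kernel coefficients are `a` and `b`. -/
def IsAB (c Δ : ℂ) (p : ℤˣ) (l : ℕ) (a b : ℂ) (Ψ : Verma c Δ) : Prop :=
  IsHighestWeight c Δ p l Ψ ∧ (∃! κ, IsNormalForm c Δ p l κ Ψ) ∧
    ∀ κ, IsNormalForm c Δ p l κ Ψ → coeffA p l κ = a ∧ coeffB p l κ = b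

/-- `Ψ` is `G`-closed if it is annihilated by `G 0`. -/
def IsGClosed {c Δ : ℂ} (Ψ : Verma c Δ) : Prop := G 0 • Ψ = 0

end Ramond

end

/-! The standard monomials applied to `|Δ⟩` form a basis of the Verma module
(Poincaré–Birkhoff–Witt), and a vector satisfying the highest weight conditions is determined by its
two kernel coefficients. Everything else is a computation of these two coefficients.

The basis is obtained in van der Waerden's way: the modes act on the space freely spanned by
standard words, the action being dictated by reordering, and the graded Jacobi identity yields all
commutation relations (`ColorLie.defect_eq_zero`). Comparison with the induced module gives
`IsVerma.toVerma_injective` and `IsVerma.toVerma_surjective`. Since `L 0` and `F` are diagonal on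
monomials, normal forms exist and are unique.

For the kernel coefficients, creation modes get weights: 2 for `L (-1)`, 1 for `G (-1)` and `G 0`, 0
for the others. Suppose a vector killed by all raising modes has no component along `L(-1)^n
G(-1)^r₁ G(0)^r₂`. In its terms of top weight, let `d` be a letter of largest mode number at most
`-2`, and let `K` be the mode of the same type with `K + d = L (-1)`. Commuting `K` through a word
replaces `d` by `L (-1)`, which gains weight 2, and every other effect gains at most 1. So a leading
coefficient survives, a contradiction (`leading_term`, `eq_zero_of_raising`). At given level and
parity at most two excluded monomials exist, hence `IsVerma.eq_zero_of_coeff`.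

The coefficients of `G_0 θ` follow by commuting `G 0` to the right modulo low weight. For `θ G_0`,
the vector `G_0|Δ⟩` obeys the defining equations of `|Δ⟩` except that its fermion parity is `-1`;
the automorphism `twist` transports the highest weight conditions, and right multiplication by `G 0`
only toggles the exponent `r₂`.

Finally `G_0² = L_0 - c/24` forces a `G`-closed singular vector to have `Δ + l' = c/24`. At that
level `G_0 Ψ` is again a highest weight vector, so it vanishes exactly when its two coefficients do,
and for `Δ = c/24 - l` those two linear equations are proportional. -/

noncomputable section

/-! ### Modules over a colour Lie algebra induced from a character: standard words and the action on
them. -/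

namespace Ramond

open Finsupp

/-- A `ℂ`-basis `x_i` of a colour Lie algebra with commutators
`x_i x_j - ε i j • x_j x_i = f i j • x_{i+j} + ω i j`, together with a character `lam` of the
subalgebra spanned by the `x_i` with `¬ neg i` and a filtration weight `wt`. -/
structure ColorLie (ι : Type) [AddCommSemigroup ι] [LinearOrder ι] where
  neg : ι → Prop
  ε : ι → ι → ℂ
  f : ι → ι → ℂ
  ω : ι → ι → ℂ
  lam : ι → ℂ
  wt : ι → ℤ
  eps_symm : ∀ i j, ε i j = ε j i
  eps_sq : ∀ i j, ε i j * ε i j = 1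
  eps_add : ∀ i j k, ε i (j + k) = ε i j * ε i k
  f_symm : ∀ i j, f i j = -ε i j * f j i
  ω_symm : ∀ i j, ω i j = -ε i j * ω j i
  -- The central element is even: a nonzero central term at `i + j` requires that degree to commute
  -- with every `k` without sign.
  ω_eps : ∀ i j k, ω i j * ε k (i + j) = ω i j
  jacobi_f : ∀ i j k, f j k * f i (j + k) = f i j * f (i + j) k + ε i j * (f i k * f j (i + k))
  jacobi_ω : ∀ i j k, f j k * ω i (j + k) = f i j * ω (i + j) k + ε i j * (f i k * ω j (i + k))
  neg_lt : ∀ i j, neg i → ¬ neg j → i < j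
  not_neg_add : ∀ i j, ¬ neg i → ¬ neg j → ¬ neg (i + j)
  lam_comm : ∀ i j, ¬ neg i → ¬ neg j →
    lam i * lam j = ε i j * (lam i * lam j) + f i j * lam (i + j) + ω i j
  wt_nonneg : ∀ i, 0 ≤ wt i
  wt_add : ∀ i j, neg j → wt (i + j) ≤ wt i + wt j

namespace ColorLie

variable {ι : Type} [AddCommSemigroup ι] [LinearOrder ι] (D : ColorLie ι)

/-- The letter `i` may stand in front of the letter `j` in a standard word. -/
def Before (i j : ι) : Prop := i < j ∨ (i = j ∧ D.ε i i = 1)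

/-- The letter `i` may be put in front of the word `w`. -/
def Fits (i : ι) (w : List ι) : Prop := D.neg i ∧ ∀ x ∈ w, D.Before i x

/-- Standard words. -/
def Std : List ι → Prop
  | [] => True
  | i :: w => D.Fits i w ∧ Std w

/-- The type of standard words. -/
abbrev Word : Type := {w : List ι // D.Std w}

/-- The empty word. -/
def nil : D.Word := ⟨[], trivial⟩

/-- Prefixing a letter to a standard word. -/
def cons (i : ι) (w : D.Word) (h : D.Fits i w.1) : D.Word := ⟨i :: w.1, h, w.2⟩

/-- The weight of a word. -/
def wtw (w : D.Word) : ℤ := (w.1.map D.wt).sum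

/-- The space with basis the standard words. -/
abbrev Space : Type := D.Word →₀ ℂ

/-- The basis vector of a standard word. -/
abbrev e (w : D.Word) : D.Space := single w 1

open Classical in
/-- The action of the letter `i` on standard words of length at most `n`. -/
def table : ℕ → ι → D.Word → D.Space
  | 0, i, w => if h : D.Fits i w.1 then D.e (D.cons i w h) else D.lam i • D.e w
  | n + 1, i, w =>
    if w.1.length ≤ n then table n i w else
    if h : D.Fits i w.1 then D.e (D.cons i w h) else
    match w with
    -- Never reached: the empty word has length at most `n`.
    | ⟨[], _⟩ => 0
    | ⟨j :: v, hw⟩ =>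
      -- Here `i` does not fit although it equals the first letter, so `ε i i = -1` and the
      -- anticommutator determines the square `x_i²`.
      if i = j then
        (1 / 2 : ℂ) • (D.f i j • table n (i + j) ⟨v, hw.2⟩ + D.ω i j • D.e ⟨v, hw.2⟩)
      else
        -- The letter `j` has to act on words that may be as long as the original tail plus one,
        -- beyond the reach of `table n`. It either fits in front of such a word or, by
        -- `X_mem_good`, the word is short enough for `table n`.
        D.ε i j • linearCombination ℂ
            (fun u : D.Word => if h : D.Fits j u.1 then D.e (D.cons j u h) else table n j u)
            (table n i ⟨v, hw.2⟩)
          + D.f i j • table n (i + j) ⟨v, hw.2⟩ + D.ω i j • D.e ⟨v, hw.2⟩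

/-- The operator by which the letter `i` acts. -/
def X (i : ι) : D.Space →ₗ[ℂ] D.Space :=
  linearCombination ℂ fun w => D.table w.1.length i w

lemma table_stable (i : ι) (w : D.Word) (n : ℕ) (h : w.1.length ≤ n) :
    D.table n i w = D.X i (D.e w) := by
  simp only [X, linearCombination_single, one_smul]
  induction n with
  | zero => simp [Nat.le_zero.mp h]
  | succ n ih =>
    by_cases h' : w.1.length ≤ n
    · rw [table, if_pos h', ih h']
    · rw [show w.1.length = n + 1 by omega]

lemma X_of_fits (i : ι) (w : D.Word) (h : D.Fits i w.1) : D.X i (D.e w) = D.e (D.cons i w h) := by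
  rw [← D.table_stable i w _ le_rfl]
  rcases hn : w.1.length with _ | n
  · rw [table, dif_pos h]
  · rw [table, if_neg (by omega), dif_pos h]

lemma X_nil (i : ι) (h : ¬ D.neg i) : D.X i (D.e D.nil) = D.lam i • D.e D.nil := by
  rw [← D.table_stable i D.nil 0 (by simp [nil]), table, dif_neg (fun h' => h h'.1)]

variable {D}

lemma eps_self (i : ι) : D.ε i i = 1 ∨ D.ε i i = -1 := mul_self_eq_one_iff.mp (D.eps_sq i i)

lemma Before.le {i j : ι} (h : D.Before i j) : i ≤ j := by
  rcases h with h | h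
  exacts [h.le, h.1.le]

lemma Before.of_lt {i j k : ι} (h : i < j) (h' : D.Before j k) : D.Before i k :=
  Or.inl (h.trans_le h'.le)

lemma Before.trans {i j k : ι} (h : D.Before i j) (h' : D.Before j k) : D.Before i k := by
  rcases h with h | ⟨rfl, h⟩
  exacts [h'.of_lt h, h']

lemma Std.neg {w : List ι} (hw : D.Std w) {x : ι} (hx : x ∈ w) : D.neg x := by
  induction w with
  | nil => simp at hx
  | cons j v ih =>
    rcases List.mem_cons.mp hx with rfl | hx
    exacts [hw.1.1, ih hw.2 hx]

lemma fits_cons {i j : ι} {v : List ι} (hij : D.neg i) (h : D.Before i j) (hv : D.Fits j v) :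
    D.Fits i (j :: v) :=
  ⟨hij, fun x hx => by
    rcases List.mem_cons.mp hx with rfl | hx
    exacts [h, h.trans (hv.2 x hx)]⟩

lemma fits_or (i : ι) {j : ι} {v : List ι} (h : D.Std (j :: v)) :
    D.Fits i (j :: v) ∨ j < i ∨ (i = j ∧ D.ε i i = -1) := by
  rcases lt_trichotomy i j with hij | rfl | hij
  · left
    have hi : D.neg i := by
      by_contra hi
      exact absurd (D.neg_lt j i h.1.1 hi) hij.asymm
    exact fits_cons hi (Or.inl hij) h.1
  · rcases D.eps_self i with h1 | h1
    · exact Or.inl (fits_cons h.1.1 (Or.inr ⟨rfl, h1⟩) h.1)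
    · exact Or.inr (Or.inr ⟨rfl, h1⟩)
  · exact Or.inr (Or.inl hij)

lemma not_fits_of_lt {i j : ι} {v : List ι} (h : j < i) : ¬ D.Fits i (j :: v) := fun h' =>
  absurd (h'.2 j (by simp)).le h.not_ge

variable (D)

lemma X_self (i : ι) (v : D.Word) (h : D.Fits i v.1) (hi : D.ε i i = -1) :
    D.X i (D.e (D.cons i v h)) =
      (1 / 2 : ℂ) • (D.f i i • D.X (i + i) (D.e v) + D.ω i i • D.e v) := by
  have hf : ¬ D.Fits i (i :: v.1) := fun h' => by
    rcases h'.2 i (by simp) with h1 | h1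
    · exact lt_irrefl _ h1
    · rw [hi] at h1; norm_num at h1
  rw [← D.table_stable i (D.cons i v h) (v.1.length + 1) (by simp [cons]), table,
    if_neg (by simp [cons]), dif_neg (by exact hf)]
  simp only [cons, if_true, D.table_stable _ _ _ le_rfl]

/-- The words that may occur in `x_i w`. -/
def good (i : ι) (w : D.Word) : Set D.Word :=
  {u | u.1.length ≤ w.1.length + 1 ∧ D.wtw u ≤ D.wt i + D.wtw w ∧
    ∀ k, k < i → D.Fits k w.1 → D.Fits k u.1 ∨ u.1.length ≤ w.1.length}

variable {D}

lemma map_mem_of_supported {V : Type*} [AddCommGroup V] [Module ℂ V] {s : Set D.Word}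
    {p : Submodule ℂ V} (T : D.Space →ₗ[ℂ] V) (h : ∀ u ∈ s, T (D.e u) ∈ p) {x : D.Space}
    (hx : x ∈ supported ℂ ℂ s) : T x ∈ p := by
  rw [supported_eq_span_single] at hx
  induction hx using Submodule.span_induction with
  | mem x hx => obtain ⟨u, hu, rfl⟩ := hx; exact h u hu
  | zero => simp
  | add x y _ _ hx hy => rw [map_add]; exact p.add_mem hx hy
  | smul a x _ hx => rw [map_smul]; exact p.smul_mem a hx

lemma eq_of_supported {V : Type*} [AddCommGroup V] [Module ℂ V] {s : Set D.Word}
    (T T' : D.Space →ₗ[ℂ] V) (h : ∀ u ∈ s, T (D.e u) = T' (D.e u)) {x : D.Space}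
    (hx : x ∈ supported ℂ ℂ s) : T x = T' x := by
  have := map_mem_of_supported (p := ⊥) (T - T') (fun u hu => by simp [h u hu]) hx
  simpa [sub_eq_zero] using this

lemma e_mem {s : Set D.Word} {u : D.Word} (h : u ∈ s) : D.e u ∈ supported ℂ ℂ s :=
  single_mem_supported ℂ 1 h

lemma supported_of_subset {s t : Set D.Word} {x : D.Space} (hx : x ∈ supported ℂ ℂ s)
    (h : s ⊆ t) : x ∈ supported ℂ ℂ t :=
  supported_mono h hx

lemma X_lt_of_good {i j : ι} (v : D.Word) (h : D.Fits j v.1) (hij : j < i)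
    (hg : D.X i (D.e v) ∈ supported ℂ ℂ (D.good i v)) :
    D.X i (D.e (D.cons j v h)) = D.ε i j • D.X j (D.X i (D.e v)) + D.f i j • D.X (i + j) (D.e v)
      + D.ω i j • D.e v := by
  rw [← D.table_stable i (D.cons j v h) (v.1.length + 1) (by simp [cons]), table,
    if_neg (by simp [cons]), dif_neg (by exact not_fits_of_lt hij)]
  simp only [cons, if_neg hij.ne', D.table_stable _ _ _ le_rfl]
  congr 3
  refine eq_of_supported _ _ (fun u hu => ?_) hg
  rw [linearCombination_single, one_smul]
  split_ifs with hj
  · rw [X_of_fits _ _ _ hj]; rfl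
  · exact D.table_stable _ _ _ ((hu.2.2 j hij h).resolve_left hj)

lemma wtw_cons (i : ι) (w : D.Word) (h : D.Fits i w.1) :
    D.wtw (D.cons i w h) = D.wt i + D.wtw w := by
  simp [wtw, cons]

/-- Terms of `x_i w` longer than `w` are rearrangements of `i` and the letters of `w`, so a letter
`k < i` that fits `w` still fits them; all commutator and scalar terms are no longer than `w`. This
length bound makes the recursion in `table` meaningful, and the weight bound is proved along with it
because it follows the same recursion. -/
lemma X_mem_good (i : ι) (w : D.Word) : D.X i (D.e w) ∈ supported ℂ ℂ (D.good i w) := by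
  induction hn : w.1.length using Nat.strong_induction_on generalizing i w with
  | _ n ih =>
  by_cases hf : D.Fits i w.1
  · rw [X_of_fits _ _ _ hf]
    refine e_mem ⟨by simp [cons], (wtw_cons i w hf).le, fun k hk hkw => Or.inl ?_⟩
    exact fits_cons hkw.1 (Or.inl hk) hf
  obtain ⟨_ | ⟨j, v⟩, hw⟩ := w
  · rw [show (⟨[], hw⟩ : D.Word) = D.nil from rfl, X_nil _ _ fun h => hf ⟨h, by simp⟩]
    refine Submodule.smul_mem _ _ (e_mem ⟨by simp, ?_, fun k _ _ => Or.inr le_rfl⟩)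
    have := D.wt_nonneg i
    linarith
  · obtain ⟨v, rfl⟩ : ∃ v' : D.Word, v = v'.1 := ⟨⟨v, hw.2⟩, rfl⟩
    have hlen : v.1.length < n := by simp at hn; omega
    change D.X i (D.e (D.cons j v hw.1)) ∈ supported ℂ ℂ (D.good i (D.cons j v hw.1))
    have h0 : D.e v ∈ supported ℂ ℂ (D.good i (D.cons j v hw.1)) := by
      refine e_mem ⟨by simp [cons]; omega, ?_, fun k _ _ => Or.inr (by simp [cons])⟩
      rw [wtw_cons]
      have := D.wt_nonneg i
      have := D.wt_nonneg j
      linarith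
    have h1 : D.X (i + j) (D.e v) ∈ supported ℂ ℂ (D.good i (D.cons j v hw.1)) := by
      refine supported_of_subset (ih _ hlen (i + j) v rfl)
        fun u hu => ⟨?_, ?_, fun k _ _ => Or.inr ?_⟩
      · have := hu.1
        simp [cons]; omega
      · have := hu.2.1
        have := D.wt_add i j hw.1.1
        rw [wtw_cons]; linarith
      · have := hu.1
        simp [cons]; omega
    rcases (fits_or i hw).resolve_left hf with hij | ⟨rfl, hi⟩
    · have hg := ih _ hlen i v rfl
      rw [X_lt_of_good v hw.1 hij hg]
      refine add_mem (add_mem (Submodule.smul_mem _ _ ?_) (Submodule.smul_mem _ _ h1))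
        (Submodule.smul_mem _ _ h0)
      refine map_mem_of_supported _ (fun u hu => ?_) hg
      by_cases hju : D.Fits j u.1
      · rw [X_of_fits _ _ _ hju]
        refine e_mem ⟨?_, ?_, fun k hk hkw => Or.inl ?_⟩
        · have := hu.1
          simp [cons]; omega
        · have := hu.2.1
          rw [wtw_cons, wtw_cons]; linarith
        · exact fits_cons hkw.1 (hkw.2 j (by simp [cons])) hju
      · have hul := (hu.2.2 j hij hw.1).resolve_left hju
        refine supported_of_subset (ih _ (hul.trans_lt hlen) j u rfl)
          fun y hy => ⟨?_, ?_, fun k _ _ => Or.inr ?_⟩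
        · have := hy.1
          simp [cons]; omega
        · have := hy.2.1
          have := hu.2.1
          rw [wtw_cons]; linarith
        · have := hy.1
          simp [cons]; omega
    · rw [X_self _ _ _ hw.1 hi]
      exact Submodule.smul_mem _ _ (add_mem (Submodule.smul_mem _ _ h1) (Submodule.smul_mem _ _ h0))

lemma X_lt {i j : ι} (v : D.Word) (h : D.Fits j v.1) (hij : j < i) :
    D.X i (D.e (D.cons j v h)) = D.ε i j • D.X j (D.X i (D.e v)) + D.f i j • D.X (i + j) (D.e v)
      + D.ω i j • D.e v :=
  X_lt_of_good v h hij (X_mem_good i v)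

/-! ### Commutation relations on the word space. -/

variable (D) in
/-- The failure of the commutation relation of `x_i` and `x_j`. -/
def defect (i j : ι) : D.Space →ₗ[ℂ] D.Space :=
  D.X i ∘ₗ D.X j - D.ε i j • D.X j ∘ₗ D.X i - D.f i j • D.X (i + j) - D.ω i j • LinearMap.id

lemma defect_apply (i j : ι) (x : D.Space) : D.defect i j x =
    D.X i (D.X j x) - D.ε i j • D.X j (D.X i x) - D.f i j • D.X (i + j) x - D.ω i j • x := rfl

lemma defect_symm (i j : ι) (x : D.Space) : D.defect i j x = -D.ε i j • D.defect j i x := by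
  simp only [defect_apply, D.eps_symm j i, add_comm j i]
  have h1 := D.eps_sq i j
  have h2 := D.f_symm i j
  have h3 := D.ω_symm i j
  match_scalars
  · linear_combination -h1
  · ring
  · linear_combination -h2
  · linear_combination -h3

/-- A formal consequence of the graded Jacobi identities: both ways of moving `x_k` through `x_i
x_j` are compared, and the relations not yet known are recorded as defects. It is the inductive step
for the vanishing of all defects. -/
lemma defect_X (i j k : ι) (x : D.Space) : D.defect i j (D.X k x) =
    (D.ε j k * D.ε i k) • D.X k (D.defect i j x) + D.ε j k • D.defect i k (D.X j x)
      + D.X i (D.defect j k x) - (D.ε i j * D.ε i k) • D.defect j k (D.X i x)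
      - D.ε i j • D.X j (D.defect i k x) + D.f j k • D.defect i (j + k) x
      - D.ε i j • D.f i k • D.defect j (i + k) x - D.f i j • D.defect (i + j) k x := by
  have h1 := D.jacobi_f i j k
  have h2 := D.jacobi_ω i j k
  have h3 := D.eps_sq i j
  have h6 := D.ω_eps j k i
  have h7 := D.ω_eps i k j
  have h8 := D.ω_eps i j k
  have e1 : i + j + k = i + (j + k) := add_assoc _ _ _
  have e2 : j + (i + k) = i + (j + k) := add_left_comm _ _ _
  simp only [D.eps_add] at h6 h7 h8
  rw [D.eps_symm k i, D.eps_symm k j] at h8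
  rw [D.eps_symm j i] at h7
  simp only [defect_apply, map_sub, map_smul, e1, e2, D.eps_add, D.eps_symm (i + j) k,
    D.eps_symm k i, D.eps_symm k j, D.eps_symm j i]
  match_scalars
  · ring
  · ring
  · ring
  · linear_combination h8
  · ring
  · ring
  · ring
  · ring
  · linear_combination (-D.ε j k * D.f i k) * h3
  · linear_combination D.ε i j * h7 - D.ω i k * D.ε j k * h3
  · ring
  · linear_combination -h6
  · ring
  · ring
  · ring
  · linear_combination h1
  · linear_combination h2

/-- When one letter fits, the action of the other on the longer word was defined by the very
relation in question. The case `i < j` reduces to `j < i` by antisymmetry, and for `i = j` either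
the relation is trivial or it is the rule for squares. -/
lemma defect_of_fits (i j : ι) (w : D.Word) (h : D.Fits j w.1) : D.defect i j (D.e w) = 0 := by
  have key : ∀ i j : ι, D.Fits j w.1 → j < i → D.defect i j (D.e w) = 0 := fun i j h hij => by
    rw [defect_apply, X_of_fits _ _ _ h, X_lt w h hij]
    abel
  rcases lt_trichotomy j i with hij | rfl | hij
  · exact key i j h hij
  · rcases D.eps_self j with h1 | h1
    · have hf : D.f j j = 0 := by
        have := D.f_symm j j
        rw [h1] at this
        linear_combination this / 2
      have hω : D.ω j j = 0 := by
        have := D.ω_symm j j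
        rw [h1] at this
        linear_combination this / 2
      simp [defect_apply, h1, hf, hω]
    · rw [defect_apply, X_of_fits _ _ _ h, D.X_self _ _ h h1, h1]
      module
  · have hi : D.neg i := by
      by_contra hi
      exact absurd (D.neg_lt j i h.1 hi) hij.asymm
    rw [defect_symm, key j i ⟨hi, fun x hx => (h.2 x hx).of_lt hij⟩ hij, smul_zero]

theorem defect_eq_zero (i j : ι) : D.defect i j = 0 := by
  refine lhom_ext' fun w => LinearMap.ext_ring ?_
  change D.defect i j (D.e w) = 0
  induction hn : w.1.length using Nat.strong_induction_on generalizing i j w with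
  | _ n ih =>
  by_cases hj : D.Fits j w.1
  · exact defect_of_fits i j w hj
  by_cases hi : D.Fits i w.1
  · rw [defect_symm, defect_of_fits j i w hi, smul_zero]
  obtain ⟨_ | ⟨k, v⟩, hw⟩ := w
  · have hi' : ¬ D.neg i := fun h => hi ⟨h, by simp⟩
    have hj' : ¬ D.neg j := fun h => hj ⟨h, by simp⟩
    rw [show (⟨[], hw⟩ : D.Word) = D.nil from rfl, defect_apply, X_nil _ _ hi', X_nil _ _ hj',
      map_smul, map_smul, X_nil _ _ hi', X_nil _ _ hj', X_nil _ _ (D.not_neg_add _ _ hi' hj')]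
    have := D.lam_comm i j hi' hj'
    match_scalars
    linear_combination this
  obtain ⟨v, rfl⟩ : ∃ v' : D.Word, v = v'.1 := ⟨⟨v, hw.2⟩, rfl⟩
  have hlen : v.1.length < n := by simp at hn; omega
  change D.defect i j (D.e (D.cons k v hw.1)) = 0
  have ih' : ∀ a b, D.defect a b (D.e v) = 0 := fun a b => ih _ hlen a b v rfl
  -- Each word of `x_b v` either admits `k` in front, where the relation holds by construction, or
  -- is shorter than the original word, where induction applies.
  have hX : ∀ a b, k < b → D.defect a k (D.X b (D.e v)) = 0 := fun a b hb => by
    rw [eq_of_supported (D.defect a k) 0 (fun u hu => ?_) (X_mem_good b v)]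
    · rfl
    by_cases hk : D.Fits k u.1
    · exact defect_of_fits a k u hk
    · exact ih _ (((hu.2.2 k hb hw.1).resolve_left hk).trans_lt hlen) a k u rfl
  have main := defect_X i j k (D.e v)
  simp only [ih', map_zero, smul_zero, add_zero, sub_zero, zero_add] at main
  rw [← D.X_of_fits k v hw.1]
  -- Neither `i` nor `j` fits, so each is either larger than the first letter `k` or an odd letter
  -- equal to it. In the latter cases the Jacobi identity returns the same defect `y`, as `y = -y`
  -- or `y = -2y`, which still gives `y = 0`.
  rcases (fits_or i hw).resolve_left hi with hik | ⟨rfl, hie⟩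
  · rcases (fits_or j hw).resolve_left hj with hjk | ⟨rfl, hje⟩
    · rw [main, hX i j hjk, hX j i hik]
      simp
    · rw [hX j i hik, hje, smul_zero, sub_zero, neg_one_smul] at main
      exact self_eq_neg.mp main
  · rcases (fits_or j hw).resolve_left hj with hjk | ⟨rfl, hje⟩
    · rw [hX i j hjk, hie, defect_symm j i, smul_smul, D.eps_symm j i, smul_zero, zero_sub,
        mul_neg_one, neg_mul_neg, D.eps_sq, one_smul] at main
      exact self_eq_neg.mp main
    · rw [hje] at main
      generalize D.defect j j (D.X j (D.e v)) = y at main ⊢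
      have h3 : (3 : ℂ) • y = y - ((-1 : ℂ) • y - (-1 * -1 : ℂ) • y) := by module
      rw [← main, sub_self] at h3
      simpa using h3

theorem X_comm (i j : ι) (x : D.Space) : D.X i (D.X j x) =
    D.ε i j • D.X j (D.X i x) + D.f i j • D.X (i + j) x + D.ω i j • x := by
  have := defect_apply i j x
  rw [defect_eq_zero, LinearMap.zero_apply] at this
  rw [← sub_eq_zero, this]
  abel

/-! ### Weight filtration and universal property of the word space. -/

/-- The words of weight at most `n`. -/
def lowWeight (D : ColorLie ι) (n : ℤ) : Submodule ℂ D.Space := supported ℂ ℂ {w | D.wtw w ≤ n}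

lemma lowWeight_mono {m n : ℤ} (h : m ≤ n) : D.lowWeight m ≤ D.lowWeight n :=
  supported_mono fun _ hw => le_trans hw h

lemma e_mem_lowWeight {w : D.Word} {n : ℤ} (h : D.wtw w ≤ n) : D.e w ∈ D.lowWeight n :=
  e_mem h

lemma X_mem_lowWeight (i : ι) {x : D.Space} {m n : ℤ} (hx : x ∈ D.lowWeight m)
    (h : D.wt i + m ≤ n) : D.X i x ∈ D.lowWeight n := by
  refine map_mem_of_supported _ (fun u hu => ?_) hx
  refine supported_of_subset (X_mem_good i u) fun w hw => ?_
  exact hw.2.1.trans (le_trans (by have : D.wtw u ≤ m := hu; linarith) h)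

/-- The linear map that interprets a standard word as a product of operators applied to `v₀`. -/
def interp {V : Type*} [AddCommGroup V] [Module ℂ V] (Y : ι → V →ₗ[ℂ] V) (v₀ : V) :
    D.Space →ₗ[ℂ] V :=
  linearCombination ℂ fun w : D.Word => w.1.foldr (fun i v => Y i v) v₀

lemma interp_e {V : Type*} [AddCommGroup V] [Module ℂ V] (Y : ι → V →ₗ[ℂ] V) (v₀ : V)
    (w : D.Word) : interp Y v₀ (D.e w) = w.1.foldr (fun i v => Y i v) v₀ := by
  simp [interp]

/-- The action on words is computed only from the relations used to reorder and from the character,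
so it is matched by any operators obeying both. Reordering only moves a letter past a letter of a
standard word, hence relations with `j` negative suffice. -/
lemma interp_X {V : Type*} [AddCommGroup V] [Module ℂ V] {Y : ι → V →ₗ[ℂ] V} {v₀ : V}
    (hY : ∀ i j v, D.neg j →
      Y i (Y j v) = D.ε i j • Y j (Y i v) + D.f i j • Y (i + j) v + D.ω i j • v)
    (hv₀ : ∀ i, ¬ D.neg i → Y i v₀ = D.lam i • v₀) (i : ι) (x : D.Space) :
    interp Y v₀ (D.X i x) = Y i (interp Y v₀ x) := by
  suffices h : interp Y v₀ ∘ₗ D.X i = Y i ∘ₗ interp Y v₀ from LinearMap.congr_fun h x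
  refine lhom_ext' fun w => LinearMap.ext_ring ?_
  change interp Y v₀ (D.X i (D.e w)) = Y i (interp Y v₀ (D.e w))
  have hcons : ∀ i (w : D.Word) (h : D.Fits i w.1),
      interp Y v₀ (D.e (D.cons i w h)) = Y i (interp Y v₀ (D.e w)) := fun i w h => by
    simp only [interp_e, cons, List.foldr_cons]
  induction hn : w.1.length using Nat.strong_induction_on generalizing i w with
  | _ n ih =>
  by_cases hi : D.Fits i w.1
  · rw [X_of_fits _ _ _ hi, hcons]
  obtain ⟨_ | ⟨k, v⟩, hw⟩ := w
  · have hi' : ¬ D.neg i := fun h => hi ⟨h, by simp⟩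
    rw [show (⟨[], hw⟩ : D.Word) = D.nil from rfl, X_nil _ _ hi', map_smul, interp_e]
    exact (hv₀ i hi').symm
  obtain ⟨v, rfl⟩ : ∃ v' : D.Word, v = v'.1 := ⟨⟨v, hw.2⟩, rfl⟩
  have hlen : v.1.length < n := by simp at hn; omega
  change interp Y v₀ (D.X i (D.e (D.cons k v hw.1))) =
    Y i (interp Y v₀ (D.e (D.cons k v hw.1)))
  have hv : ∀ a, interp Y v₀ (D.X a (D.e v)) = Y a (interp Y v₀ (D.e v)) :=
    fun a => ih _ hlen a v rfl
  rw [hcons]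
  rcases (fits_or i hw).resolve_left hi with hik | ⟨rfl, hie⟩
  · rw [hY _ _ _ hw.1.1, X_lt v hw.1 hik, map_add, map_add, map_smul, map_smul, map_smul, hv, ← hv i]
    congr 3
    refine eq_of_supported (interp Y v₀ ∘ₗ D.X k) (Y k ∘ₗ interp Y v₀) (fun u hu => ?_)
      (X_mem_good i v)
    by_cases hk : D.Fits k u.1
    · rw [LinearMap.comp_apply, X_of_fits _ _ _ hk, hcons]
      rfl
    · exact ih _ (((hu.2.2 k hik hw.1).resolve_left hk).trans_lt hlen) k u rfl
  · have h2 := hY i i (interp Y v₀ (D.e v)) hw.1.1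
    rw [hie, neg_one_smul, add_assoc, ← sub_eq_iff_eq_add', sub_neg_eq_add, ← two_smul ℂ] at h2
    rw [D.X_self _ _ hw.1 hie, map_smul, map_add, map_smul, map_smul, hv, ← h2, smul_smul]
    norm_num

end ColorLie
end Ramond
end

/-! ### The Ramond modes as a colour Lie algebra. -/

noncomputable section

set_option linter.unusedSimpArgs false

namespace Ramond

open Finsupp

/-- The modes of the Ramond algebra. -/
inductive Mode : Type
  | L (m : ℤ)
  | G (m : ℤ)

namespace Mode

/-- The mode number. -/
def idx : Mode → ℤ
  | L m => m
  | G m => m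

instance : Add Mode where
  add
    | L m, L n => L (m + n)
    | L m, G n => G (m + n)
    | G m, L n => G (m + n)
    | G m, G n => L (m + n)

@[simp] lemma L_add_L (m n : ℤ) : L m + L n = L (m + n) := rfl
@[simp] lemma L_add_G (m n : ℤ) : L m + G n = G (m + n) := rfl
@[simp] lemma G_add_L (m n : ℤ) : G m + L n = G (m + n) := rfl
@[simp] lemma G_add_G (m n : ℤ) : G m + G n = L (m + n) := rfl

instance : AddCommSemigroup Mode where
  add_assoc x y z := by cases x <;> cases y <;> cases z <;> simp [add_assoc]
  add_comm x y := by cases x <;> cases y <;> simp [add_comm]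

/-- The position of a mode in the standard monomials, up to the mode number. -/
def rank : Mode → ℕ
  | L m => if m ≤ -2 then 0 else if m = -1 then 2 else 5
  | G m => if m ≤ -2 then 1 else if m = -1 then 3 else if m = 0 then 4 else 6

/-- The key by which modes are ordered in the standard monomials. -/
def key (x : Mode) : ℕ ×ₗ ℤ := toLex (x.rank, x.idx)

lemma key_injective : Function.Injective key := by
  intro x y h
  simp only [key, toLex_inj, Prod.mk.injEq] at h
  obtain ⟨h, h'⟩ := h
  cases x <;> cases y <;> simp only [rank, idx] at h h' <;> subst h'
  · rfl
  · split_ifs at h <;> simp at h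
  · split_ifs at h <;> simp at h
  · rfl

instance : LinearOrder Mode := LinearOrder.lift' key key_injective

lemma lt_iff {x y : Mode} : x < y ↔ x.rank < y.rank ∨ x.rank = y.rank ∧ x.idx < y.idx := by
  change x.key < y.key ↔ _
  rw [Prod.Lex.lt_iff]
  rfl

/-- The creation modes. -/
def neg : Mode → Prop
  | L m => m < 0
  | G m => m ≤ 0

/-- The sign for commuting two modes. -/
def ε : Mode → Mode → ℂ
  | G _, G _ => -1
  | _, _ => 1

/-- The structure constants of the Ramond algebra. -/
def f : Mode → Mode → ℂ
  | L m, L n => (m : ℂ) - n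
  | L m, G n => (m : ℂ) / 2 - n
  | G m, L n => m - (n : ℂ) / 2
  | G _, G _ => 2

/-- The central terms of the Ramond algebra. -/
def ω (c : ℂ) : Mode → Mode → ℂ
  | L m, L n => (if m + n = 0 then ((m : ℂ) ^ 3 - m) / 12 else 0) * c
  | G m, G n => (if m + n = 0 then ((m : ℂ) ^ 2 - 1 / 4) / 3 else 0) * c
  | _, _ => 0

/-- The highest weight. -/
def lam (Δ : ℂ) : Mode → ℂ
  | L m => if m = 0 then Δ else 0
  | G _ => 0

/-- The filtration weight, for which `L (-1)` dominates. -/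
def wt : Mode → ℤ
  | L m => if m ≤ -2 then 0 else if m = 0 then 0 else 2
  | G m => if m ≤ -2 then 0 else if m ≤ 0 then 1 else 2

end Mode

open Mode in
/-- The Ramond algebra, without the parity operator and at fixed central charge. -/
def alg (c Δ : ℂ) : ColorLie Mode where
  neg := neg
  ε := ε
  f := f
  ω := ω c
  lam := lam Δ
  wt := wt
  eps_symm i j := by cases i <;> cases j <;> rfl
  eps_sq i j := by cases i <;> cases j <;> simp [ε]
  eps_add i j k := by cases i <;> cases j <;> cases k <;> simp [ε]
  f_symm i j := by cases i <;> cases j <;> simp [ε, f]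
  ω_symm i j := by
    cases i with
    | L m => cases j with
      | L n =>
        simp only [ε, ω, add_comm n m]
        split_ifs with h
        · obtain rfl : n = -m := by omega
          push_cast; ring
        · simp
      | G n => simp [ω]
    | G m => cases j with
      | L n => simp [ω]
      | G n =>
        simp only [ε, ω, add_comm n m]
        split_ifs with h
        · obtain rfl : n = -m := by omega
          push_cast; ring
        · simp
  ω_eps i j k := by cases i <;> cases j <;> cases k <;> simp [ε, ω]
  jacobi_f i j k := by
    cases i <;> cases j <;> cases k <;> simp only [f, ε, L_add_L, L_add_G, G_add_L, G_add_G] <;>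
      push_cast <;> ring
  jacobi_ω i j k := by
    cases i <;> cases j <;> cases k <;>
      simp only [f, ε, ω, L_add_L, L_add_G, G_add_L, G_add_G, mul_zero, add_zero] <;>
      rename_i i j k <;>
      rw [show j + (i + k) = i + j + k by ring, show i + (j + k) = i + j + k by ring] <;>
      split_ifs with h <;> try simp
    all_goals
      obtain rfl : k = -i - j := by omega
      push_cast
      ring
  neg_lt i j hi hj := by
    rw [lt_iff]
    cases i <;> cases j <;> simp only [neg, rank, idx] at * <;> split_ifs <;> omega
  not_neg_add i j hi hj := by
    cases i <;> cases j <;> simp only [neg, L_add_L, L_add_G, G_add_L, G_add_G] at * <;> omega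
  lam_comm i j hi hj := by
    cases i <;> cases j <;> simp only [neg] at hi hj <;> rename_i m n <;>
      simp only [lam, f, ε, ω, L_add_L, L_add_G, G_add_L, G_add_G, mul_zero, zero_mul, add_zero]
    -- For nonnegative modes the central term can only occur at `m = n = 0`, where `m³ - m`
    -- vanishes.
    · rw [show (if m + n = 0 then ((m : ℂ) ^ 3 - m) / 12 else 0) = 0 by
        split_ifs with h
        · obtain rfl : m = 0 := by omega
          simp
        · rfl]
      split_ifs with h h' <;> try simp
      · subst h h'; simp
      all_goals omega
    -- Only `G m` with `m ≥ 1` belong to the subalgebra, so `m + n > 0` and both sides vanish.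
    -- Including `G 0` with character value zero would force `Δ = c/24`, which is why it counts as a
    -- creation mode.
    · rw [if_neg (by omega), if_neg (by omega)]; simp
  wt_nonneg i := by cases i <;> simp only [wt] <;> split_ifs <;> simp
  wt_add i j hj := by
    cases i <;> cases j <;> simp only [neg, wt, L_add_L, L_add_G, G_add_L, G_add_G] at * <;>
      split_ifs <;> omega


lemma ColorLie.std_iff {ι : Type} [AddCommSemigroup ι] [LinearOrder ι] {D : ColorLie ι}
    {w : List ι} : D.Std w ↔ w.Pairwise D.Before ∧ ∀ x ∈ w, D.neg x := by
  induction w with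
  | nil => simp [ColorLie.Std]
  | cons i w ih =>
    simp only [ColorLie.Std, ColorLie.Fits, ih, List.pairwise_cons, List.forall_mem_cons]
    tauto

variable {c Δ : ℂ}

@[simp] lemma alg_neg : (alg c Δ).neg = Mode.neg := rfl
@[simp] lemma alg_ε : (alg c Δ).ε = Mode.ε := rfl
@[simp] lemma alg_f : (alg c Δ).f = Mode.f := rfl
@[simp] lemma alg_ω : (alg c Δ).ω = Mode.ω c := rfl
@[simp] lemma alg_lam : (alg c Δ).lam = Mode.lam Δ := rfl
@[simp] lemma alg_wt : (alg c Δ).wt = Mode.wt := rfl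

/-! ### Labels of standard monomials and standard words. -/

namespace Label

/-- The word of modes of a standard monomial. -/
def word (X : Label) : List Mode :=
  (X.Ls.sort (· ≥ ·)).map (fun m : ℕ => Mode.L (-(m : ℤ))) ++
    ((X.Gs.sort (· ≥ ·)).map (fun m : ℕ => Mode.G (-(m : ℤ))) ++
      (List.replicate X.n (Mode.L (-1)) ++
        (List.replicate X.r₁ (Mode.G (-1)) ++ List.replicate X.r₂ (Mode.G 0))))

lemma mem_word {X : Label} {x : Mode} : x ∈ X.word ↔
    (∃ m ∈ X.Ls, Mode.L (-(m : ℤ)) = x) ∨ (∃ m ∈ X.Gs, Mode.G (-(m : ℤ)) = x) ∨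
      (X.n ≠ 0 ∧ x = Mode.L (-1)) ∨ ((X.r₁ : ℕ) ≠ 0 ∧ x = Mode.G (-1)) ∨
        ((X.r₂ : ℕ) ≠ 0 ∧ x = Mode.G 0) := by
  simp only [word, List.mem_append, List.mem_map, Multiset.mem_sort, Finset.mem_sort,
    List.mem_replicate]

lemma neg_of_mem_word {X : Label} {x : Mode} (hx : x ∈ X.word) : x.neg := by
  rcases mem_word.mp hx with ⟨m, hm, rfl⟩ | ⟨m, hm, rfl⟩ | ⟨-, rfl⟩ | ⟨-, rfl⟩ | ⟨-, rfl⟩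
  · have := X.two_le_L m hm
    simp only [Mode.neg]; omega
  · have := X.two_le_G m hm
    simp only [Mode.neg]; omega
  all_goals simp [Mode.neg]

lemma pairwise_replicate_fin {R : Mode → Mode → Prop} (r : Fin 2) (x : Mode) :
    (List.replicate r x).Pairwise R := by
  fin_cases r <;> simp

lemma std_word (X : Label) : (alg c Δ).Std X.word := by
  refine ColorLie.std_iff.mpr ⟨?_, fun x hx => neg_of_mem_word hx⟩
  have hL := X.two_le_L
  have hG := X.two_le_G
  simp only [word, List.pairwise_append, List.mem_append, List.mem_map, Multiset.mem_sort,
    Finset.mem_sort, List.mem_replicate, List.pairwise_map, pairwise_replicate_fin, true_and,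
    List.pairwise_replicate, ColorLie.Before, Mode.lt_iff, alg_ε, Mode.ε, and_true, or_true]
  refine ⟨?_, ⟨?_, ?_, ?_⟩, ?_⟩
  · refine (Multiset.pairwise_sort X.Ls (· ≥ ·)).imp_of_mem fun {a b} ha hb h => ?_
    have ha := hL a (by simpa using ha)
    have hb := hL b (by simpa using hb)
    rcases h.eq_or_lt with rfl | h
    · exact Or.inr rfl
    · simp only [Mode.rank, Mode.idx]
      split_ifs <;> omega
  · refine (Finset.sortedGT_sort X.Gs).pairwise.imp_of_mem fun {a b} ha hb h => ?_
    have ha := hG a (by simpa using ha)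
    have hb := hG b (by simpa using hb)
    simp only [Mode.rank, Mode.idx]
    split_ifs <;> omega
  · refine ⟨⟨Or.inl (by omega), Or.inl (by omega), ?_⟩, ?_⟩
    · rintro _ ⟨-, rfl⟩ _ ⟨-, rfl⟩
      simp [Mode.rank]
    · rintro _ ⟨-, rfl⟩ _ (⟨-, rfl⟩ | ⟨-, rfl⟩) <;> simp [Mode.rank]
  · rintro _ ⟨a, ha, rfl⟩ _ (⟨-, rfl⟩ | ⟨-, rfl⟩ | ⟨-, rfl⟩)
    all_goals
      have := hG a ha
      simp only [Mode.rank]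
      left; left
      split_ifs <;> omega
  · rintro _ ⟨a, ha, rfl⟩ _ (⟨b, hb, rfl⟩ | ⟨-, rfl⟩ | ⟨-, rfl⟩ | ⟨-, rfl⟩)
    · have := hL a ha
      have := hG b hb
      simp only [Mode.rank]
      left; left
      split_ifs <;> omega
    all_goals
      have := hL a ha
      simp only [Mode.rank]
      left; left
      split_ifs <;> omega

lemma count_word (X : Label) (x : Mode) : X.word.count x =
    (X.Ls.map fun m : ℕ => Mode.L (-(m : ℤ))).count x +
      (X.Gs.val.map fun m : ℕ => Mode.G (-(m : ℤ))).count x +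
      (if x = Mode.L (-1) then X.n else 0) + (if x = Mode.G (-1) then (X.r₁ : ℕ) else 0) +
      (if x = Mode.G 0 then (X.r₂ : ℕ) else 0) := by
  have h1 := congrArg (fun s => (s.map fun m : ℕ => Mode.L (-(m : ℤ))).count x)
    (Multiset.sort_eq X.Ls (· ≥ ·))
  have h2 := congrArg (fun s => (s.map fun m : ℕ => Mode.G (-(m : ℤ))).count x)
    (Finset.sort_eq X.Gs (· ≥ ·))
  simp only [Multiset.map_coe, Multiset.coe_count] at h1 h2
  simp only [word, List.count_append, List.count_replicate, h1, h2, beq_iff_eq, eq_comm (b := x)]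
  ring

lemma L_neg_injective : Function.Injective fun m : ℕ => Mode.L (-(m : ℤ)) := fun a b h => by
  simpa using h

lemma G_neg_injective : Function.Injective fun m : ℕ => Mode.G (-(m : ℤ)) := fun a b h => by
  simpa using h

lemma count_word_L (X : Label) {m : ℕ} (hm : 2 ≤ m) :
    X.word.count (Mode.L (-(m : ℤ))) = X.Ls.count m := by
  have h1 : Mode.L (-(m : ℤ)) ≠ Mode.L (-1) := by simp; omega
  rw [count_word, Multiset.count_map_eq_count' _ _ L_neg_injective,
    Multiset.count_eq_zero_of_notMem (s := X.Gs.val.map _) (by simp), if_neg h1]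
  simp

lemma count_word_G (X : Label) {m : ℕ} (hm : 2 ≤ m) :
    X.word.count (Mode.G (-(m : ℤ))) = X.Gs.val.count m := by
  have h1 : Mode.G (-(m : ℤ)) ≠ Mode.G (-1) := by simp; omega
  have h2 : Mode.G (-(m : ℤ)) ≠ Mode.G 0 := by simp; omega
  rw [count_word, Multiset.count_map_eq_count' _ _ G_neg_injective,
    Multiset.count_eq_zero_of_notMem (by simp), if_neg h1, if_neg h2]
  simp

lemma count_word_L_one (X : Label) : X.word.count (Mode.L (-1)) = X.n := by
  rw [count_word, Multiset.count_eq_zero_of_notMem, Multiset.count_eq_zero_of_notMem]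
  · simp
  · simp
  · intro h
    obtain ⟨m, hm, h⟩ := Multiset.mem_map.mp h
    have := X.two_le_L m hm
    simp at h; omega

lemma count_word_G_one (X : Label) : X.word.count (Mode.G (-1)) = X.r₁ := by
  rw [count_word, Multiset.count_eq_zero_of_notMem, Multiset.count_eq_zero_of_notMem]
  · simp
  · intro h
    obtain ⟨m, hm, h⟩ := Multiset.mem_map.mp h
    have := X.two_le_G m hm
    simp at h; omega
  · simp

lemma count_word_G_zero (X : Label) : X.word.count (Mode.G 0) = X.r₂ := by
  rw [count_word, Multiset.count_eq_zero_of_notMem, Multiset.count_eq_zero_of_notMem]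
  · simp
  · intro h
    obtain ⟨m, hm, h⟩ := Multiset.mem_map.mp h
    have := X.two_le_G m hm
    simp at h; omega
  · simp

/-- The multiplicities of the letters in the word recover every field of the label. -/
lemma word_injective : Function.Injective word := by
  intro X Y h
  have key : ∀ x, X.word.count x = Y.word.count x := fun x => by rw [h]
  refine Label.ext ?_ ?_ ?_ ?_ ?_
  · ext m
    by_cases hm : 2 ≤ m
    · rw [← count_word_L X hm, ← count_word_L Y hm, h]
    · rw [Multiset.count_eq_zero_of_notMem fun h => hm (X.two_le_L m h),
        Multiset.count_eq_zero_of_notMem fun h => hm (Y.two_le_L m h)]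
  · refine Finset.val_injective ?_
    ext m
    by_cases hm : 2 ≤ m
    · rw [← count_word_G X hm, ← count_word_G Y hm, h]
    · rw [Multiset.count_eq_zero_of_notMem fun h => hm (X.two_le_G m h),
        Multiset.count_eq_zero_of_notMem fun h => hm (Y.two_le_G m h)]
  · rw [← count_word_L_one X, ← count_word_L_one Y, h]
  · exact Fin.ext (by rw [← count_word_G_one X, ← count_word_G_one Y, h])
  · exact Fin.ext (by rw [← count_word_G_zero X, ← count_word_G_zero Y, h])

/-- Built up letter by letter from the right: since the new first letter stands before all others,
its rank forces every block of smaller rank to be empty, and an odd letter cannot be repeated. -/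
lemma exists_word_eq {w : List Mode} (hw : (alg c Δ).Std w) : ∃ X : Label, X.word = w := by
  induction w with
  | nil => exact ⟨⟨0, ∅, 0, 0, 0, by simp, by simp⟩, by simp [word]⟩
  | cons i w ih =>
    obtain ⟨X, rfl⟩ := ih hw.2
    obtain ⟨hi, hX⟩ := hw.1
    simp only [ColorLie.Before, Mode.lt_iff, alg_ε, alg_neg] at hi hX
    have key : ∀ x ∈ X.word, i.rank < x.rank ∨ i.rank = x.rank ∧ (i.idx < x.idx ∨
        i = x ∧ Mode.ε i i = 1) := fun x hx => by
      rcases hX x hx with h | ⟨h, h'⟩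
      · tauto
      · exact Or.inr ⟨h ▸ rfl, Or.inr ⟨h, h'⟩⟩
    have hLs : i.rank ≠ 0 → X.Ls = 0 := fun h =>
      Multiset.eq_zero_of_forall_notMem fun m hm => by
        have h1 := key _ (mem_word.mpr (Or.inl ⟨m, hm, rfl⟩))
        have h2 : (Mode.L (-(m : ℤ))).rank = 0 := if_pos (by have := X.two_le_L m hm; omega)
        omega
    have hGs : 1 < i.rank → X.Gs = ∅ := fun h =>
      Finset.eq_empty_of_forall_notMem fun m hm => by
        have h1 := key _ (mem_word.mpr (Or.inr (Or.inl ⟨m, hm, rfl⟩)))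
        have h2 : (Mode.G (-(m : ℤ))).rank = 1 := if_pos (by have := X.two_le_G m hm; omega)
        omega
    have hn : 2 < i.rank → X.n = 0 := fun h => by
      by_contra hm
      have h1 := key _ (mem_word.mpr (Or.inr (Or.inr (Or.inl ⟨hm, rfl⟩))))
      have h2 : (Mode.L (-1)).rank = 2 := rfl
      omega
    have hr₁ : 3 < i.rank ∨ i = Mode.G (-1) → X.r₁ = 0 := fun h => by
      by_contra hm
      have hm : (X.r₁ : ℕ) ≠ 0 := fun h => hm (Fin.ext h)
      have h1 := key _ (mem_word.mpr (Or.inr (Or.inr (Or.inr (Or.inl ⟨hm, rfl⟩)))))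
      rcases h with h | rfl
      · have h2 : (Mode.G (-1)).rank = 3 := rfl
        omega
      · norm_num [Mode.ε] at h1
    have hr₂ : 4 < i.rank ∨ i = Mode.G 0 → X.r₂ = 0 := fun h => by
      by_contra hm
      have hm : (X.r₂ : ℕ) ≠ 0 := fun h => hm (Fin.ext h)
      have h1 := key _ (mem_word.mpr (Or.inr (Or.inr (Or.inr (Or.inr ⟨hm, rfl⟩)))))
      rcases h with h | rfl
      · have h2 : (Mode.G 0).rank = 4 := rfl
        omega
      · norm_num [Mode.ε] at h1
    obtain ⟨Ls, Gs, n, r₁, r₂, hL, hG⟩ := X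
    simp only at hLs hGs hn hr₁ hr₂
    cases i with
    | L m =>
      by_cases hm : m ≤ -2
      · obtain ⟨k, rfl⟩ : ∃ k : ℕ, m = -k := ⟨m.natAbs, by omega⟩
        refine ⟨⟨k ::ₘ Ls, Gs, n, r₁, r₂, ?_, hG⟩, ?_⟩
        · intro b hb
          rcases Multiset.mem_cons.mp hb with rfl | hb
          exacts [by omega, hL b hb]
        · simp only [word]
          rw [Multiset.sort_cons]
          · rfl
          · intro b hb
            have h1 := key _ (mem_word.mpr (Or.inl ⟨b, hb, rfl⟩))
            have h2 := hL b hb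
            simp only [Mode.rank, Mode.idx, Mode.L.injEq] at h1
            rw [if_pos (by omega), if_pos (by omega)] at h1
            omega
      · obtain rfl : m = -1 := by
          have : m < 0 := hi
          omega
        obtain rfl := hLs (by decide)
        obtain rfl := hGs (by decide)
        exact ⟨⟨0, ∅, n + 1, r₁, r₂, by simp, by simp⟩, by simp [word, List.replicate_succ]⟩
    | G m =>
      obtain rfl := hLs (by simp only [Mode.rank]; split_ifs <;> simp)
      by_cases hm : m ≤ -2
      · obtain ⟨k, rfl⟩ : ∃ k : ℕ, m = -k := ⟨m.natAbs, by omega⟩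
        have hk : ∀ b ∈ Gs, b < k := fun b hb => by
          have h1 := key _ (mem_word.mpr (Or.inr (Or.inl ⟨b, hb, rfl⟩)))
          have h2 := hG b hb
          have h3 : ¬ Mode.ε (.G (-(k : ℤ))) (.G (-(k : ℤ))) = 1 := by norm_num [Mode.ε]
          simp only [Mode.rank, Mode.idx, h3] at h1
          rw [if_pos (by omega), if_pos (by omega)] at h1
          simp only [and_false, or_false] at h1
          omega
        refine ⟨⟨0, insert k Gs, n, r₁, r₂, by simp, ?_⟩, ?_⟩
        · intro b hb
          rcases Finset.mem_insert.mp hb with rfl | hb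
          exacts [by omega, hG b hb]
        · simp only [word]
          rw [Finset.sort_insert _ (fun b hb => (hk b hb).le) (fun h => (hk k h).false)]
          simp
      · obtain rfl := hGs (by simp only [Mode.rank]; split_ifs <;> simp)
        obtain rfl := hn (by simp only [Mode.rank]; split_ifs <;> simp)
        have : m ≤ 0 := hi
        obtain rfl | rfl : m = -1 ∨ m = 0 := by omega
        · obtain rfl := hr₁ (Or.inr rfl)
          exact ⟨⟨0, ∅, 0, 1, r₂, by simp, by simp⟩, by simp [word]⟩
        · obtain rfl := hr₁ (Or.inl (by decide))
          obtain rfl := hr₂ (Or.inr rfl)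
          exact ⟨⟨0, ∅, 0, 0, 1, by simp, by simp⟩, by simp [word]⟩

variable (c Δ) in
/-- Labels correspond to standard words. -/
def equivWord : Label ≃ (alg c Δ).Word :=
  Equiv.ofBijective (fun X => ⟨X.word, X.std_word⟩)
    ⟨fun _ _ h => word_injective (Subtype.ext_iff.mp h), fun w =>
      (exists_word_eq w.2).imp fun _ h => Subtype.ext h⟩

lemma equivWord_coe (X : Label) : (equivWord c Δ X).1 = X.word := rfl

end Label

end Ramond
end

/-! ### The enveloping algebra and the identification of the Verma module with the word space. -/

noncomputable section

set_option linter.unusedSimpArgs false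
set_option linter.unusedSectionVars false

namespace Ramond

open Finsupp

/-- The mode as an element of the enveloping algebra. -/
def Mode.op : Mode → U
  | .L m => Ramond.L m
  | .G m => Ramond.G m

/-- The parity of a mode as a sign. -/
def Mode.sgn : Mode → ℂ
  | .L _ => 1
  | .G _ => -1

lemma Mode.op_comm (i j : Mode) : i.op * j.op =
    Mode.ε i j • (j.op * i.op) + Mode.f i j • (i + j).op + Mode.ω 1 i j • C := by
  cases i with
  | L m => cases j with
    | L n =>
      have := RingQuot.mkAlgHom_rel ℂ (Rel.LL m n)
      simp only [map_sub, map_mul, map_add, map_smul] at this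
      simp only [Mode.ε, Mode.f, Mode.ω, op, Ramond.L, C, Mode.L_add_L, mul_one, one_smul]
      rw [add_assoc, ← this]
      abel
    | G n =>
      have := RingQuot.mkAlgHom_rel ℂ (Rel.LG m n)
      simp only [map_sub, map_mul, map_add, map_smul] at this
      simp only [Mode.ε, Mode.f, Mode.ω, op, Ramond.L, Ramond.G, Mode.L_add_G, one_smul, zero_smul]
      rw [add_zero, ← this]
      abel
  | G m => cases j with
    | L n =>
      have := RingQuot.mkAlgHom_rel ℂ (Rel.LG n m)
      simp only [map_sub, map_mul, map_add, map_smul] at this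
      rw [sub_eq_iff_eq_add] at this
      simp only [Mode.ε, Mode.f, Mode.ω, op, Ramond.L, Ramond.G, Mode.G_add_L, add_comm m n]
      rw [this]
      module
    | G n =>
      have := RingQuot.mkAlgHom_rel ℂ (Rel.GG m n)
      simp only [map_mul, map_add, map_smul] at this
      simp only [Mode.ε, Mode.f, Mode.ω, op, Ramond.L, Ramond.G, C, Mode.G_add_G, mul_one]
      rw [add_assoc, ← this]
      module

lemma C_comm (i : Mode) : C * i.op = i.op * C := by
  cases i with
  | L m =>
    have := RingQuot.mkAlgHom_rel ℂ (Rel.LC m)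
    simp only [map_sub, map_mul, map_zero] at this
    exact (sub_eq_zero.mp this).symm
  | G m =>
    have := RingQuot.mkAlgHom_rel ℂ (Rel.GC m)
    simp only [map_sub, map_mul, map_zero] at this
    exact (sub_eq_zero.mp this).symm

lemma C_comm_F : C * F = F * C := by
  have := RingQuot.mkAlgHom_rel ℂ Rel.FC
  simp only [map_sub, map_mul, map_zero] at this
  exact (sub_eq_zero.mp this).symm

lemma F_comm (i : Mode) : F * i.op = i.sgn • (i.op * F) := by
  cases i with
  | L m =>
    have := RingQuot.mkAlgHom_rel ℂ (Rel.FL m)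
    simp only [map_sub, map_mul, map_zero] at this
    simpa [Mode.sgn, Mode.op, F, L] using sub_eq_zero.mp this
  | G m =>
    have := RingQuot.mkAlgHom_rel ℂ (Rel.FG m)
    simp only [map_add, map_mul, map_zero] at this
    exact (eq_neg_of_add_eq_zero_left this).trans (neg_one_smul ℂ _).symm

/-- Induction over the enveloping algebra. -/
lemma U.induction {p : U → Prop} (hop : ∀ i : Mode, p i.op) (hC : p C) (hF : p F)
    (hs : ∀ a : ℂ, p (algebraMap ℂ U a)) (hadd : ∀ x y, p x → p y → p (x + y))
    (hmul : ∀ x y, p x → p y → p (x * y)) (x : U) : p x := by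
  obtain ⟨y, rfl⟩ := RingQuot.mkAlgHom_surjective ℂ Rel x
  induction y using FreeAlgebra.induction with
  | grade0 a => simpa using hs a
  | grade1 g =>
    cases g with
    | L m => exact hop (.L m)
    | G m => exact hop (.G m)
    | C => exact hC
    | F => exact hF
  | add x y hx hy => rw [map_add]; exact hadd _ _ hx hy
  | mul x y hx hy => rw [map_mul]; exact hmul _ _ hx hy

lemma C_central (x : U) : C * x = x * C := by
  induction x using U.induction with
  | hop i => exact C_comm i
  | hC => rfl
  | hF => exact C_comm_F
  | hs a => exact (Algebra.commutes a C).symm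
  | hadd x y hx hy => rw [mul_add, add_mul, hx, hy]
  | hmul x y hx hy => rw [← mul_assoc, hx, mul_assoc, hy, mul_assoc]

/-- `V` is a Verma module with highest weight vector `v₀`. -/
structure IsVerma {V : Type} [AddCommGroup V] [Module U V] (c Δ : ℂ) (v₀ : V) : Prop where
  smul_eq_zero : ∀ u : U, u • v₀ = 0 ↔ u ∈ vermaIdeal c Δ
  exists_smul : ∀ Ψ : V, ∃ u : U, Ψ = u • v₀

lemma isVerma_vac (c Δ : ℂ) : IsVerma c Δ (vac c Δ) where
  smul_eq_zero u := by
    rw [vac, ← Submodule.Quotient.mk_smul, smul_eq_mul, mul_one, Submodule.Quotient.mk_eq_zero]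
  exists_smul Ψ := by
    obtain ⟨u, rfl⟩ := Submodule.Quotient.mk_surjective _ Ψ
    exact ⟨u, by rw [vac, ← Submodule.Quotient.mk_smul, smul_eq_mul, mul_one]⟩

variable {c Δ : ℂ} {V : Type} [AddCommGroup V] [Module ℂ V] [Module U V] [IsScalarTower ℂ U V]
  {v₀ : V}

namespace IsVerma

variable (H : IsVerma c Δ v₀)
include H

lemma C_smul (Ψ : V) : C • Ψ = c • Ψ := by
  obtain ⟨u, rfl⟩ := H.exists_smul Ψ
  have h : C • v₀ = c • v₀ := by
    rw [← sub_eq_zero, ← algebraMap_smul U c v₀, ← sub_smul, H.smul_eq_zero]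
    exact Submodule.subset_span (Or.inr (by simp))
  rw [← mul_smul, C_central, mul_smul, h, smul_comm]

lemma F_smul_vac : F • v₀ = v₀ := by
  rw [← sub_eq_zero]
  nth_rw 2 [← one_smul U v₀]
  rw [← sub_smul, H.smul_eq_zero]
  exact Submodule.subset_span (Or.inr (by simp))

lemma op_smul_vac (i : Mode) (hi : ¬ i.neg) : i.op • v₀ = Mode.lam Δ i • v₀ := by
  cases i with
  | L m =>
    simp only [Mode.neg, not_lt] at hi
    simp only [Mode.lam, Mode.op]
    rcases hi.eq_or_lt with rfl | hi
    · rw [if_pos rfl, ← sub_eq_zero, ← algebraMap_smul U Δ v₀, ← sub_smul, H.smul_eq_zero]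
      exact Submodule.subset_span (Or.inr (by simp))
    · rw [if_neg hi.ne', zero_smul, H.smul_eq_zero]
      exact Submodule.subset_span (Or.inl ⟨m, hi, Or.inl rfl⟩)
  | G m =>
    simp only [Mode.neg, not_le] at hi
    simp only [Mode.lam, Mode.op]
    rw [zero_smul, H.smul_eq_zero]
    exact Submodule.subset_span (Or.inl ⟨m, hi, Or.inr rfl⟩)

end IsVerma

lemma Mode.ω_eq (i j : Mode) : Mode.ω c i j = Mode.ω 1 i j * c := by
  cases i <;> cases j <;> simp [Mode.ω]

lemma F_op_smul (i : Mode) (Ψ : V) : F • i.op • Ψ = i.sgn • i.op • F • Ψ := by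
  rw [← mul_smul, F_comm, smul_assoc, mul_smul]

variable (c Δ) in
/-- The map from the space of standard words to a module with a chosen vector. -/
def toVerma (v₀ : V) : (alg c Δ).Space →ₗ[ℂ] V :=
  ColorLie.interp (fun i => Algebra.lsmul ℂ ℂ V i.op) v₀

namespace IsVerma

variable (H : IsVerma c Δ v₀)
include H

lemma op_op_smul (i j : Mode) (Ψ : V) : i.op • j.op • Ψ =
    Mode.ε i j • j.op • i.op • Ψ + Mode.f i j • (i + j).op • Ψ + Mode.ω c i j • Ψ := by
  rw [← mul_smul, Mode.op_comm, add_smul, add_smul, smul_assoc, smul_assoc, smul_assoc, mul_smul,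
    H.C_smul, smul_smul _ c, ← Mode.ω_eq]

lemma toVerma_X (i : Mode) (x : (alg c Δ).Space) :
    toVerma c Δ v₀ ((alg c Δ).X i x) = i.op • toVerma c Δ v₀ x :=
  ColorLie.interp_X (D := alg c Δ) (fun i j v _ => H.op_op_smul i j v)
    (fun i hi => H.op_smul_vac i hi) i x

lemma F_smul_word (w : List Mode) : F • (w.map Mode.op).prod • v₀ =
    (w.map Mode.sgn).prod • (w.map Mode.op).prod • v₀ := by
  induction w with
  | nil => simp [H.F_smul_vac]
  | cons i w ih =>
    simp only [List.map_cons, List.prod_cons, mul_smul]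
    rw [F_op_smul, ih, smul_comm i.op]

end IsVerma

lemma toVerma_nil : toVerma c Δ v₀ ((alg c Δ).e (alg c Δ).nil) = v₀ := by
  rw [toVerma, ColorLie.interp_e]; rfl

lemma toVerma_e (w : (alg c Δ).Word) :
    toVerma c Δ v₀ ((alg c Δ).e w) = (w.1.map Mode.op).prod • v₀ := by
  obtain ⟨w, hw⟩ := w
  rw [toVerma, ColorLie.interp_e]
  simp only
  clear hw
  induction w with
  | nil => simp
  | cons i w ih =>
    rw [List.foldr_cons, ih, List.map_cons, List.prod_cons, mul_smul]
    rfl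

/-- The image contains `v₀` and is stable under all generators: modes act through the word space,
`C` is a scalar, and `F` multiplies each word by its sign. -/
lemma IsVerma.toVerma_surjective (H : IsVerma c Δ v₀) :
    Function.Surjective (toVerma c Δ v₀) := by
  have key : ∀ (u : U) (x : (alg c Δ).Space), ∃ y, toVerma c Δ v₀ y = u • toVerma c Δ v₀ x := by
    intro u
    induction u using U.induction with
    | hop i => exact fun x => ⟨_, H.toVerma_X i x⟩
    | hC => exact fun x => ⟨c • x, by rw [map_smul, H.C_smul]⟩
    | hF =>
      intro x
      suffices h : x ∈ (LinearMap.range (toVerma c Δ v₀)).comap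
          ((Algebra.lsmul ℂ ℂ V F).comp (toVerma c Δ v₀)) from h
      induction x using Finsupp.induction_linear with
      | zero => exact Submodule.zero_mem _
      | add x y hx hy => exact Submodule.add_mem _ hx hy
      | single w a =>
        rw [← mul_one a, ← smul_eq_mul, ← smul_single]
        refine Submodule.smul_mem _ _
          ⟨(w.1.map Mode.sgn).prod • (alg c Δ).e w, ?_⟩
        change _ = F • toVerma c Δ v₀ ((alg c Δ).e w)
        rw [map_smul, toVerma_e, H.F_smul_word]
    | hs a => exact fun x => ⟨a • x, by rw [map_smul, algebraMap_smul]⟩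
    | hadd u v hu hv =>
      intro x
      obtain ⟨y, hy⟩ := hu x
      obtain ⟨z, hz⟩ := hv x
      exact ⟨y + z, by rw [map_add, hy, hz, add_smul]⟩
    | hmul u v hu hv =>
      intro x
      obtain ⟨z, hz⟩ := hv x
      obtain ⟨y, hy⟩ := hu z
      exact ⟨y, by rw [hy, hz, mul_smul]⟩
  intro Ψ
  obtain ⟨u, rfl⟩ := H.exists_smul Ψ
  obtain ⟨y, hy⟩ := key u ((alg c Δ).e (alg c Δ).nil)
  exact ⟨y, by rw [hy, toVerma_nil]⟩

variable (c Δ) in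
/-- The parity operator on the space of standard words. -/
def parityOp : (alg c Δ).Space →ₗ[ℂ] (alg c Δ).Space :=
  ColorLie.interp (fun i => i.sgn • (alg c Δ).X i) ((alg c Δ).e (alg c Δ).nil)

/-- The operators `sgn i • X i` satisfy the same relations and act on the empty word by the same
character, so the universal property applies with the word space itself as target. -/
lemma parityOp_X (i : Mode) (x : (alg c Δ).Space) :
    parityOp c Δ ((alg c Δ).X i x) = i.sgn • (alg c Δ).X i (parityOp c Δ x) := by
  refine ColorLie.interp_X (D := alg c Δ) (fun i j v _ => ?_) (fun i hi => ?_) i x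
  · have := ColorLie.X_comm (D := alg c Δ) i j v
    simp only [LinearMap.smul_apply, map_smul]
    rw [this]
    cases i <;> cases j <;>
      simp [Mode.sgn, Mode.ε, Mode.f, Mode.ω]
  · rw [LinearMap.smul_apply, ColorLie.X_nil _ _ hi]
    cases i <;> simp [Mode.sgn, Mode.lam]

lemma parityOp_nil : parityOp c Δ ((alg c Δ).e (alg c Δ).nil) = (alg c Δ).e (alg c Δ).nil := by
  rw [parityOp, ColorLie.interp_e]; rfl

variable (c Δ) in
/-- The generators as operators on the space of standard words. -/
def genOp : Gen → Module.End ℂ (alg c Δ).Space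
  | .L m => (alg c Δ).X (.L m)
  | .G m => (alg c Δ).X (.G m)
  | .C => c • 1
  | .F => parityOp c Δ

lemma genOp_rel {x y : FreeAlgebra ℂ Gen} (h : Rel x y) :
    FreeAlgebra.lift ℂ (genOp c Δ) x = FreeAlgebra.lift ℂ (genOp c Δ) y := by
  have hX := ColorLie.X_comm (D := alg c Δ)
  cases h with
  | LL m n =>
    refine LinearMap.ext fun x => ?_
    simp only [map_sub, map_add, map_mul, map_smul, gen, FreeAlgebra.lift_ι_apply, genOp,
      LinearMap.sub_apply, LinearMap.add_apply, LinearMap.smul_apply, Module.End.mul_apply,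
      Module.End.one_apply]
    rw [hX (.L m) (.L n)]
    simp only [alg_ε, alg_f, alg_ω, Mode.ε, Mode.f, Mode.ω, Mode.L_add_L]
    module
  | LG m n =>
    refine LinearMap.ext fun x => ?_
    simp only [map_sub, map_add, map_mul, map_smul, gen, FreeAlgebra.lift_ι_apply, genOp,
      LinearMap.sub_apply, LinearMap.add_apply, LinearMap.smul_apply, Module.End.mul_apply]
    rw [hX (.L m) (.G n)]
    simp only [alg_ε, alg_f, alg_ω, Mode.ε, Mode.f, Mode.ω, Mode.L_add_G]
    module
  | GG m n =>
    refine LinearMap.ext fun x => ?_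
    simp only [map_sub, map_add, map_mul, map_smul, gen, FreeAlgebra.lift_ι_apply, genOp,
      LinearMap.sub_apply, LinearMap.add_apply, LinearMap.smul_apply, Module.End.mul_apply,
      Module.End.one_apply]
    rw [hX (.G m) (.G n)]
    simp only [alg_ε, alg_f, alg_ω, Mode.ε, Mode.f, Mode.ω, Mode.G_add_G]
    module
  | LC m => simp [genOp]
  | GC m => simp [genOp]
  | FL m =>
    refine LinearMap.ext fun x => ?_
    simp [genOp, parityOp_X, Mode.sgn]
  | FC => simp [genOp]
  | FG m =>
    refine LinearMap.ext fun x => ?_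
    simp [genOp, parityOp_X, Mode.sgn]

variable (c Δ) in
/-- The action of the enveloping algebra on the space of standard words. -/
def rep : U →ₐ[ℂ] Module.End ℂ (alg c Δ).Space :=
  RingQuot.liftAlgHom ℂ ⟨FreeAlgebra.lift ℂ (genOp c Δ), fun _ _ h => genOp_rel h⟩

lemma rep_gen (x : Gen) : rep c Δ (RingQuot.mkAlgHom ℂ Rel (gen x)) = genOp c Δ x := by
  rw [rep, RingQuot.liftAlgHom_mkAlgHom_apply, FreeAlgebra.lift_ι_apply]

lemma rep_op (i : Mode) : rep c Δ i.op = (alg c Δ).X i := by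
  cases i <;> exact rep_gen _

lemma rep_eq_zero {u : U} (hu : u ∈ vermaIdeal c Δ) :
    rep c Δ u ((alg c Δ).e (alg c Δ).nil) = 0 := by
  induction hu using Submodule.span_induction with
  | mem x hx =>
    rcases hx with ⟨m, hm, rfl | rfl⟩ | rfl | rfl | rfl
    · rw [show L m = (Mode.L m).op from rfl, rep_op, ColorLie.X_nil]
      · simp [Mode.lam, show m ≠ 0 by omega]
      · simp [Mode.neg]; omega
    · rw [show G m = (Mode.G m).op from rfl, rep_op, ColorLie.X_nil]
      · simp [Mode.lam]
      · simp [Mode.neg]; omega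
    · rw [show L 0 = (Mode.L 0).op from rfl, map_sub, rep_op, LinearMap.sub_apply, ColorLie.X_nil]
      · simp [Mode.lam]
      · simp [Mode.neg]
    · rw [map_sub, show rep c Δ C = c • 1 from rep_gen _, AlgHom.commutes]
      simp
    · rw [map_sub, show rep c Δ F = parityOp c Δ from rep_gen _, map_one]
      simp [parityOp_nil]
  | zero => simp
  | add x y _ _ hx hy => rw [map_add, LinearMap.add_apply, hx, hy, add_zero]
  | smul a x _ hx => rw [smul_eq_mul, map_mul, Module.End.mul_apply, hx, map_zero]

lemma rep_word (w : (alg c Δ).Word) :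
    rep c Δ (w.1.map Mode.op).prod ((alg c Δ).e (alg c Δ).nil) = (alg c Δ).e w := by
  obtain ⟨w, hw⟩ := w
  simp only
  induction w with
  | nil => simp; rfl
  | cons i w ih =>
    rw [List.map_cons, List.prod_cons, map_mul, Module.End.mul_apply, ih hw.2, rep_op,
      ColorLie.X_of_fits _ _ _ hw.1]
    rfl

/-- The word space carries a representation of `U` in which the empty word is annihilated by
`vermaIdeal`. If `x` maps to zero, the `u` that represents `x` lies in that ideal, and applying `u`
to the empty word gives `x` on the one hand and zero on the other. -/
lemma IsVerma.toVerma_injective (H : IsVerma c Δ v₀) :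
    Function.Injective (toVerma c Δ v₀) := by
  have key : ∀ x : (alg c Δ).Space, ∃ u : U, toVerma c Δ v₀ x = u • v₀ ∧
      rep c Δ u ((alg c Δ).e (alg c Δ).nil) = x := by
    intro x
    induction x using Finsupp.induction_linear with
    | zero => exact ⟨0, by simp⟩
    | add x y hx hy =>
      obtain ⟨u, hu, hu'⟩ := hx
      obtain ⟨v, hv, hv'⟩ := hy
      exact ⟨u + v, by rw [map_add, hu, hv, add_smul],
        by rw [map_add, LinearMap.add_apply, hu', hv']⟩
    | single w a =>
      refine ⟨a • (w.1.map Mode.op).prod, ?_, ?_⟩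
      · rw [← mul_one a, ← smul_eq_mul, ← smul_single, map_smul, toVerma_e, smul_eq_mul, mul_one,
          smul_assoc]
      · rw [map_smul, LinearMap.smul_apply, rep_word, smul_single, smul_eq_mul, mul_one]
  refine (injective_iff_map_eq_zero _).mpr fun x hx => ?_
  obtain ⟨u, hu, rfl⟩ := key x
  exact rep_eq_zero ((H.smul_eq_zero u).mp (hu.symm.trans hx))

end Ramond
end

/-! ### Leading terms of raising modes and vanishing of vectors without kernel components. -/

noncomputable section

set_option linter.unusedSimpArgs false

namespace Ramond

open Finsupp

variable {c Δ : ℂ}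

namespace Mode

lemma lt_L_neg_one_iff {x : Mode} : x < L (-1) ↔ x.idx ≤ -2 := by
  rw [lt_iff]
  cases x <;> simp only [rank, idx] <;> split_ifs <;> omega

lemma wt_of_idx_le {x : Mode} (h : x.idx ≤ -2) : x.wt = 0 := by
  cases x <;> exact if_pos h

lemma idx_add (x y : Mode) : (x + y).idx = x.idx + y.idx := by
  cases x <;> cases y <;> rfl

/-- By maximality of `d`, another letter `j` of mode number at most `-2` is sent to mode number at
most `-1`, and `-1` only by the mode of opposite type to `d`, giving `G (-1)` of weight 1. The
letters `L (-1)`, `G (-1)`, `G 0` already have weight at least 1, while no mode exceeds 2. -/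
lemma wt_add_le {K d j : Mode} (hd : d.idx ≤ -2) (hK : K + d = L (-1)) (hj : j.neg) (hjd : j ≠ d)
    (h : j.idx ≤ -2 → j.idx ≤ d.idx) : (K + j).wt ≤ 1 + j.wt := by
  cases K <;> cases d <;> cases j <;>
    simp only [L_add_L, L_add_G, G_add_L, G_add_G, L.injEq, G.injEq, ne_eq, reduceCtorEq, neg, idx,
      wt] at * <;> split_ifs <;> omega

lemma f_ne_zero {K d : Mode} (hd : d.idx ≤ -2) (hK : K + d = L (-1)) : f K d ≠ 0 := by
  cases K with
  | L k => cases d with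
    | L m =>
      simp only [L_add_L, L.injEq, idx] at *
      obtain rfl : k = -1 - m := by omega
      simp only [f]
      intro h
      have : ((-1 - m - m : ℤ) : ℂ) = 0 := by push_cast at h ⊢; exact h
      have : (-1 - m - m : ℤ) = 0 := by exact_mod_cast this
      omega
    | G m => simp at hK
  | G k => cases d with
    | L m => simp at hK
    | G m => simp [f]

lemma ε_of_add {K d : Mode} (hK : K + d = L (-1)) (hd : ε d d = 1) (j : Mode) : ε K j = 1 := by
  cases K with
  | L k => rfl
  | G k => cases d with
    | L m => simp at hK
    | G m => norm_num [ε] at hd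

lemma ε_eq (i j : Mode) : ε i j = 1 ∨ ε i j = -1 := by
  cases i <;> cases j <;> simp [ε]

lemma wt_le_two (i : Mode) : i.wt ≤ 2 := by
  cases i <;> simp only [wt] <;> split_ifs <;> simp

end Mode

namespace ColorLie

variable {ι : Type} [AddCommSemigroup ι] [LinearOrder ι] {D : ColorLie ι}

lemma Word.eq_of_perm {u w : D.Word} (h : u.1.Perm w.1) : u = w :=
  Subtype.ext (h.eq_of_pairwise (le := D.Before)
    (fun _ _ _ _ h h' => le_antisymm h.le h'.le) (std_iff.mp u.2).1 (std_iff.mp w.2).1)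

lemma wtw_eq_of_perm {u : D.Word} {l : List ι} (h : u.1.Perm l) :
    D.wtw u = (l.map D.wt).sum :=
  (h.map _).sum_eq

lemma fits_of_perm {i : ι} {u v : List ι} (h : u.Perm v) (hv : D.Fits i v) : D.Fits i u :=
  ⟨hv.1, fun x hx => hv.2 x (h.mem_iff.mp hx)⟩

end ColorLie

open ColorLie Mode

/-- Moving `L (-1)` to its place passes only letters of mode number at most `-2`; the commutators
have mode number at most `-3`, hence weight 0, so the gain of 2 carried by `L (-1)` is lost in them.
-/
lemma exists_insert (w : (alg c Δ).Word) : ∃ u : (alg c Δ).Word, u.1.Perm (.L (-1) :: w.1) ∧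
    (alg c Δ).X (.L (-1)) ((alg c Δ).e w) - (alg c Δ).e u ∈
      (alg c Δ).lowWeight ((alg c Δ).wtw w + 1) := by
  by_cases hf : (alg c Δ).Fits (.L (-1)) w.1
  · exact ⟨(alg c Δ).cons _ w hf, List.Perm.refl _, by simp [X_of_fits _ _ _ hf]⟩
  obtain ⟨w, hw⟩ := w
  induction w with
  | nil => exact absurd ⟨by simp [Mode.neg], by simp⟩ hf
  | cons j v ih =>
    have hj : j < .L (-1) := by
      rcases (fits_or _ hw).resolve_left hf with h | ⟨-, h⟩
      · exact h
      · norm_num [Mode.ε] at h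
    have hwt := wt_of_idx_le (lt_L_neg_one_iff.mp hj)
    have ih' : ∃ u : (alg c Δ).Word, u.1.Perm (.L (-1) :: v) ∧
        (alg c Δ).X (.L (-1)) ((alg c Δ).e ⟨v, hw.2⟩) - (alg c Δ).e u ∈
          (alg c Δ).lowWeight ((alg c Δ).wtw ⟨v, hw.2⟩ + 1) := by
      by_cases hv : (alg c Δ).Fits (.L (-1)) v
      · exact ⟨(alg c Δ).cons _ ⟨v, hw.2⟩ hv, List.Perm.refl _, by
          rw [X_of_fits _ _ ⟨v, hw.2⟩ hv, sub_self]; exact Submodule.zero_mem _⟩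
      · exact ih hw.2 hv
    obtain ⟨u, hu, hu'⟩ := ih'
    have hju : (alg c Δ).Fits j u.1 := fits_of_perm hu
      ⟨hw.1.1, by simpa using ⟨Or.inl hj, hw.1.2⟩⟩
    refine ⟨(alg c Δ).cons j u hju, (hu.cons j).trans (List.Perm.swap _ _ _), ?_⟩
    have h1 := X_lt (D := alg c Δ) ⟨v, hw.2⟩ hw.1 hj
    change (alg c Δ).X (.L (-1)) ((alg c Δ).e ((alg c Δ).cons j ⟨v, hw.2⟩ hw.1)) - _ ∈
      (alg c Δ).lowWeight ((alg c Δ).wtw ((alg c Δ).cons j ⟨v, hw.2⟩ hw.1) + 1)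
    have h0 : 0 ≤ j.wt := (alg c Δ).wt_nonneg j
    have h2 : (-1 + j.idx : ℤ) ≤ -2 := by have := lt_L_neg_one_iff.mp hj; omega
    have h3 := wt_of_idx_le (x := .L (-1) + j) (by rw [idx_add]; exact h2)
    have m1 : (alg c Δ).X j ((alg c Δ).X (.L (-1)) ((alg c Δ).e ⟨v, hw.2⟩) - (alg c Δ).e u) ∈
        (alg c Δ).lowWeight (j.wt + (alg c Δ).wtw ⟨v, hw.2⟩ + 1) :=
      X_mem_lowWeight _ hu' (by rw [alg_wt, add_assoc])
    have m2 : (alg c Δ).X (.L (-1) + j) ((alg c Δ).e ⟨v, hw.2⟩) ∈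
        (alg c Δ).lowWeight (j.wt + (alg c Δ).wtw ⟨v, hw.2⟩ + 1) :=
      X_mem_lowWeight _ (e_mem_lowWeight le_rfl) (by rw [alg_wt, h3]; linarith)
    have m3 : (alg c Δ).e ⟨v, hw.2⟩ ∈
        (alg c Δ).lowWeight (j.wt + (alg c Δ).wtw ⟨v, hw.2⟩ + 1) :=
      e_mem_lowWeight (by linarith)
    rw [map_sub, X_of_fits _ _ _ hju] at m1
    rw [h1, wtw_cons]
    simp only [alg_ε, alg_f, alg_ω, alg_wt, show Mode.ε (.L (-1)) j = 1 from rfl]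
    convert add_mem (add_mem m1 (Submodule.smul_mem _ (Mode.f (.L (-1)) j) m2))
      (Submodule.smul_mem _ (Mode.ω c (.L (-1)) j) m3) using 1
    module

/-- The leading term of a raising mode `K` on a standard word, when `d = -1 - K` is the largest
mode number below `-1` that occurs. -/
lemma leading_term {K d : Mode} (hd : d.idx ≤ -2) (hK : K + d = .L (-1)) (w : (alg c Δ).Word)
    (hw : ∀ x ∈ w.1, x.idx ≤ -2 → x.idx ≤ d.idx) :
    (d ∉ w.1 → (alg c Δ).X K ((alg c Δ).e w) ∈ (alg c Δ).lowWeight ((alg c Δ).wtw w + 1)) ∧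
    (d ∈ w.1 → ∃ (s : ℂ) (u : (alg c Δ).Word), (s = 1 ∨ s = -1) ∧ (Mode.ε d d = 1 → s = 1) ∧
      u.1.Perm (.L (-1) :: w.1.erase d) ∧
      (alg c Δ).X K ((alg c Δ).e w) - (s * Mode.f K d * w.1.count d) • (alg c Δ).e u ∈
        (alg c Δ).lowWeight ((alg c Δ).wtw w + 1)) := by
  have hKneg : ¬ K.neg := by
    have h1 := idx_add K d
    rw [hK] at h1
    cases K <;> simp only [Mode.neg, idx] at * <;> omega
  have hdlt : d < .L (-1) := lt_L_neg_one_iff.mpr hd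
  obtain ⟨w, hstd⟩ := w
  induction w with
  | nil =>
    refine ⟨fun _ => ?_, fun h => absurd h (by simp)⟩
    rw [show (⟨[], hstd⟩ : (alg c Δ).Word) = (alg c Δ).nil from rfl, X_nil _ _ hKneg]
    exact Submodule.smul_mem _ _ (e_mem_lowWeight (by linarith))
  | cons j v ih =>
    obtain ⟨ih1, ih2⟩ := ih hstd.2 fun x hx => hw x (List.mem_cons_of_mem _ hx)
    obtain ⟨v, rfl⟩ : ∃ v' : (alg c Δ).Word, v = v'.1 := ⟨⟨v, hstd.2⟩, rfl⟩
    change _ → (alg c Δ).X K ((alg c Δ).e v) ∈ (alg c Δ).lowWeight ((alg c Δ).wtw v + 1) at ih1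
    have hX : (alg c Δ).X K ((alg c Δ).e ⟨j :: v.1, hstd⟩) =
        Mode.ε K j • (alg c Δ).X j ((alg c Δ).X K ((alg c Δ).e v)) +
        Mode.f K j • (alg c Δ).X (K + j) ((alg c Δ).e v) + Mode.ω c K j • (alg c Δ).e v := by
      have := X_comm (D := alg c Δ) K j ((alg c Δ).e v)
      rwa [X_of_fits _ _ _ hstd.1] at this
    have hwt : (alg c Δ).wtw ⟨j :: v.1, hstd⟩ = j.wt + (alg c Δ).wtw v := wtw_cons j v hstd.1
    have hj0 : 0 ≤ j.wt := (alg c Δ).wt_nonneg j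
    have hω : Mode.ω c K j • (alg c Δ).e v ∈
        (alg c Δ).lowWeight ((alg c Δ).wtw ⟨j :: v.1, hstd⟩ + 1) :=
      Submodule.smul_mem _ _ (e_mem_lowWeight (by linarith))
    have hXj : ∀ x ∈ (alg c Δ).lowWeight ((alg c Δ).wtw v + 1), (alg c Δ).X j x ∈
        (alg c Δ).lowWeight ((alg c Δ).wtw ⟨j :: v.1, hstd⟩ + 1) := fun x hx =>
      X_mem_lowWeight _ hx (by rw [hwt, alg_wt]; linarith)
    by_cases hjd : j = d
    · subst hjd
      refine ⟨fun h => absurd List.mem_cons_self h, fun _ => ?_⟩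
      obtain ⟨u₀, hu₀, hu₀'⟩ := exists_insert v
      refine ⟨1, u₀, Or.inl rfl, fun _ => rfl, by simpa using hu₀, ?_⟩
      rw [hwt, wt_of_idx_le hd, zero_add] at hω hXj ⊢
      rw [hX, hK]
      -- A repeated `d` must be even; then `K` is even as well, all signs are 1, and the copies of
      -- `d` contribute the same word, adding up to the multiplicity. An odd `d` occurs once.
      by_cases hv : j ∈ v.1
      · have hε : Mode.ε j j = 1 := by
          rcases hstd.1.2 j hv with h | h
          · exact absurd h (lt_irrefl _)
          · exact h.2
        obtain ⟨s, u, -, hs, hu, hu'⟩ := ih2 hv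
        obtain rfl := hs hε
        have hju : (alg c Δ).Fits j u.1 := fits_of_perm hu ⟨hstd.1.1, by
          simpa using ⟨Or.inl hdlt, fun x hx => hstd.1.2 x (List.mem_of_mem_erase hx)⟩⟩
        have huu : (alg c Δ).cons j u hju = u₀ := Word.eq_of_perm <|
          (hu.cons j).trans <| (List.Perm.swap _ _ _).trans <|
            ((List.perm_cons_erase hv).symm.cons _).trans hu₀.symm
        have h1 := hXj _ hu'
        rw [map_sub, map_smul] at h1
        erw [X_of_fits _ _ _ hju] at h1
        rw [huu] at h1
        rw [ε_of_add hK hε]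
        have h2 := add_mem (add_mem h1 (Submodule.smul_mem _ (Mode.f K j) hu₀')) hω
        convert h2 using 1
        simp only [List.count_cons_self]
        push_cast
        module
      · have h1 := hXj _ (ih1 hv)
        have h2 := add_mem (add_mem (Submodule.smul_mem _ (Mode.ε K j) h1)
          (Submodule.smul_mem _ (Mode.f K j) hu₀')) hω
        convert h2 using 1
        simp only [List.count_cons_self, List.count_eq_zero_of_not_mem hv]
        push_cast
        module
    -- The commutator of `K` with a letter other than `d` gains at most weight 1, so it stays below
    -- the leading term.
    · have hlow : Mode.f K j • (alg c Δ).X (K + j) ((alg c Δ).e v) ∈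
          (alg c Δ).lowWeight ((alg c Δ).wtw ⟨j :: v.1, hstd⟩ + 1) := by
        refine Submodule.smul_mem _ _ (X_mem_lowWeight _ (e_mem_lowWeight le_rfl) ?_)
        have := wt_add_le hd hK hstd.1.1 hjd (hw j List.mem_cons_self)
        rw [hwt, alg_wt]
        linarith
      constructor
      · intro h
        rw [hX]
        exact add_mem (add_mem (Submodule.smul_mem _ _
          (hXj _ (ih1 fun h' => h (List.mem_cons_of_mem _ h')))) hlow) hω
      · intro h
        have hv : d ∈ v.1 := (List.mem_cons.mp h).resolve_left (Ne.symm hjd)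
        obtain ⟨s, u, hs1, hs2, hu, hu'⟩ := ih2 hv
        have hju : (alg c Δ).Fits j u.1 := fits_of_perm hu ⟨hstd.1.1, by
          simpa using ⟨Or.inl ((hstd.1.2 d hv).le.trans_lt hdlt),
            fun x hx => hstd.1.2 x (List.mem_of_mem_erase hx)⟩⟩
        refine ⟨Mode.ε K j * s, (alg c Δ).cons j u hju, ?_, ?_, ?_, ?_⟩
        · rcases hs1 with rfl | rfl <;> rcases ε_eq K j with h | h <;> simp [h]
        · intro h
          rw [ε_of_add hK h, hs2 h, mul_one]
        · rw [List.erase_cons_tail (by simpa using hjd)]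
          exact (hu.cons j).trans (List.Perm.swap _ _ _)
        · have h1 := hXj _ hu'
          rw [map_sub, map_smul] at h1
          erw [X_of_fits _ _ _ hju] at h1
          rw [hX, List.count_cons_of_ne hjd]
          have h2 := add_mem (add_mem (Submodule.smul_mem _ (Mode.ε K j) h1) hlow) hω
          convert h2 using 1
          module

/-- A vector without components along the monomials in `L (-1)`, `G (-1)`, `G 0` that is
annihilated by all raising modes vanishes. -/
theorem eq_zero_of_raising {ψ : (alg c Δ).Space}
    (h : ∀ i : Mode, 1 ≤ i.idx → (alg c Δ).X i ψ = 0)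
    (hψ : ∀ w ∈ ψ.support, ∃ x ∈ w.1, x.idx ≤ -2) : ψ = 0 := by
  classical
  -- The leading term is sought among the words of top weight `W`, with `d` of largest mode number
  -- at most `-2` occurring in any of them.
  by_contra hne
  obtain ⟨w₁, hw₁, hmax⟩ := ψ.support.exists_max_image (alg c Δ).wtw (support_nonempty_iff.mpr hne)
  set W := (alg c Δ).wtw w₁
  let letters : Finset Mode := (ψ.support.filter fun w => (alg c Δ).wtw w = W).biUnion
    fun w => w.1.toFinset.filter fun x => x.idx ≤ -2
  have hmem : ∀ x, x ∈ letters ↔ ∃ w ∈ ψ.support, (alg c Δ).wtw w = W ∧ x ∈ w.1 ∧ x.idx ≤ -2 :=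
    fun x => by simp [letters, and_assoc]
  obtain ⟨d, hdl, hdmax⟩ := letters.exists_max_image idx <| by
    obtain ⟨x, hx, hx'⟩ := hψ w₁ hw₁
    exact ⟨x, (hmem x).mpr ⟨w₁, hw₁, rfl, hx, hx'⟩⟩
  obtain ⟨w₀, hw₀, hW₀, hdw₀, hd⟩ := (hmem d).mp hdl
  obtain ⟨K, hK⟩ : ∃ K, K + d = .L (-1) := by
    cases d with
    | L m => exact ⟨.L (-1 - m), by simp⟩
    | G m => exact ⟨.G (-1 - m), by simp⟩
  have hKidx : 1 ≤ K.idx := by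
    have := idx_add K d
    rw [hK] at this
    change -1 = _ at this
    omega
  have hcond : ∀ w ∈ ψ.support, (alg c Δ).wtw w = W → ∀ x ∈ w.1, x.idx ≤ -2 → x.idx ≤ d.idx :=
    fun w hw hwW x hx hx' => hdmax x ((hmem x).mpr ⟨w, hw, hwW, hx, hx'⟩)
  obtain ⟨s, u₀, hs, -, hu₀, hlead⟩ := (leading_term hd hK w₀ (hcond w₀ hw₀ hW₀)).2 hdw₀
  have hperm : ∀ {u w : (alg c Δ).Word}, d ∈ w.1 → u.1.Perm (.L (-1) :: w.1.erase d) →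
      (alg c Δ).wtw u = (alg c Δ).wtw w + 2 := fun {u w} hdw hu => by
    have h1 := ((List.perm_cons_erase hdw).map Mode.wt).sum_eq
    rw [List.map_cons, List.sum_cons, wt_of_idx_le hd] at h1
    rw [wtw_eq_of_perm hu, List.map_cons, List.sum_cons, alg_wt, wtw, alg_wt, h1,
      show (Mode.L (-1)).wt = 2 from rfl]
    ring
  have hlow : ∀ x ∈ (alg c Δ).lowWeight (W + 1), x u₀ = 0 := fun x hx => by
    by_contra hx'
    have : (alg c Δ).wtw u₀ ≤ W + 1 := (mem_supported ℂ x).mp hx (mem_support_iff.mpr hx')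
    rw [hperm hdw₀ hu₀, hW₀] at this
    omega
  -- No other word contributes to `u₀`, whose weight is `W + 2`: a word of lower weight cannot reach
  -- it since `K` has weight at most 2, and a word of top weight with the same leading word has the
  -- same letters, hence equals `w₀`.
  have hzero : ∀ w ∈ ψ.support, w ≠ w₀ → (alg c Δ).X K ((alg c Δ).e w) u₀ = 0 := by
    intro w hw hne
    rcases (hmax w hw).lt_or_eq with hlt | heq
    · refine hlow _ (X_mem_lowWeight K (e_mem_lowWeight le_rfl) ?_)
      have := wt_le_two K
      rw [alg_wt]
      omega
    · obtain ⟨h1, h2⟩ := leading_term hd hK w (hcond w hw heq)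
      rw [heq] at h1 h2
      by_cases hdw : d ∈ w.1
      · obtain ⟨s', u, -, -, hu, hlead'⟩ := h2 hdw
        have := hlow _ hlead'
        have huu : u ≠ u₀ := fun huu => hne <| Word.eq_of_perm <| by
          subst huu
          exact (List.perm_cons_erase hdw).trans
            ((((hu.symm.trans hu₀).cons_inv).cons d).trans (List.perm_cons_erase hdw₀).symm)
        simpa [single_apply, huu] using this
      · exact hlow _ (h1 hdw)
  have hsum : (alg c Δ).X K ψ u₀ = ψ w₀ * (alg c Δ).X K ((alg c Δ).e w₀) u₀ := by
    conv_lhs => rw [← ψ.sum_single]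
    rw [Finsupp.sum, map_sum, finsetSum_apply, Finset.sum_eq_single w₀]
    · rw [← mul_one (ψ w₀), ← smul_eq_mul, ← smul_single, map_smul]
      simp
    · intro w hw hne
      rw [← mul_one (ψ w), ← smul_eq_mul, ← smul_single, map_smul, Finsupp.smul_apply, hzero w hw hne,
        smul_zero]
    · exact fun h => absurd hw₀ h
  have h1 := hlow _ (hW₀ ▸ hlead)
  rw [h K hKidx] at hsum
  simp only [Finsupp.sub_apply, Finsupp.smul_apply, single_eq_same, smul_eq_mul, mul_one, sub_eq_zero] at h1
  rw [h1] at hsum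
  have hcount : (w₀.1.count d : ℂ) ≠ 0 := by
    exact_mod_cast (List.count_pos_iff.mpr hdw₀).ne'
  have hs' : s ≠ 0 := by rcases hs with rfl | rfl <;> simp
  exact mul_ne_zero (mem_support_iff.mp hw₀) (mul_ne_zero (mul_ne_zero hs' (f_ne_zero hd hK)) hcount)
    hsum.symm

end Ramond
end

/-! ### Kernel monomials and the action of `G 0` on them. -/

noncomputable section

set_option linter.unusedSimpArgs false
set_option linter.unusedSectionVars false

namespace Ramond

open Finsupp ColorLie

variable {c Δ : ℂ}

namespace Label

lemma mono_eq (X : Label) : X.mono = (X.word.map Mode.op).prod := by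
  simp [mono, word, Function.comp_def, Mode.op, mul_assoc]

lemma sum_word_idx (X : Label) : (X.word.map Mode.idx).sum = -(X.level : ℤ) := by
  have h1 := congrArg (fun s => (s.map fun m : ℕ => -(m : ℤ)).sum) (Multiset.sort_eq X.Ls (· ≥ ·))
  have h2 := congrArg (fun s => (s.map fun m : ℕ => -(m : ℤ)).sum) (Finset.sort_eq X.Gs (· ≥ ·))
  simp only [Multiset.map_coe, Multiset.sum_coe] at h1 h2
  simp only [word, List.map_append, List.map_map, Function.comp_def, Mode.idx, List.sum_append,
    List.map_replicate, List.sum_replicate, h1, h2, level, Multiset.sum_map_neg]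
  have h3 : (X.Ls.map fun m : ℕ => (m : ℤ)).sum = (X.Ls.sum : ℤ) :=
    (map_multiset_sum (Nat.castAddMonoidHom ℤ) X.Ls).symm
  have h4 : (X.Gs.val.map fun m : ℕ => (m : ℤ)).sum = ((∑ m ∈ X.Gs, m : ℕ) : ℤ) := by
    push_cast; rfl
  rw [h3, h4]
  push_cast
  simp
  ring

lemma sum_word_wt (X : Label) : (X.word.map Mode.wt).sum = 2 * X.n + (X.r₁ : ℕ) + (X.r₂ : ℕ) := by
  have h1 : ((X.Ls.sort (· ≥ ·)).map fun m : ℕ => (Mode.L (-(m : ℤ))).wt).sum = 0 :=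
    List.sum_eq_zero fun x hx => by
      obtain ⟨m, hm, rfl⟩ := List.mem_map.mp hx
      have := X.two_le_L m (by simpa using hm)
      exact if_pos (by omega)
  have h2 : ((X.Gs.sort (· ≥ ·)).map fun m : ℕ => (Mode.G (-(m : ℤ))).wt).sum = 0 :=
    List.sum_eq_zero fun x hx => by
      obtain ⟨m, hm, rfl⟩ := List.mem_map.mp hx
      have := X.two_le_G m (by simpa using hm)
      exact if_pos (by omega)
  simp only [word, List.map_append, List.map_map, Function.comp_def, List.sum_append,
    List.map_replicate, List.sum_replicate, h1, h2]
  simp [Mode.wt]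
  ring

lemma prod_word_sgn (X : Label) : (X.word.map Mode.sgn).prod = (((X.parity : ℤˣ) : ℤ) : ℂ) := by
  simp [word, Function.comp_def, Mode.sgn, parity, pow_add, mul_assoc]

/-- The label of the first kernel coefficient. -/
def kerA (p : ℤˣ) (l : ℕ) : Label := ⟨0, ∅, l, 0, if p = 1 then 0 else 1, by simp, by simp⟩

/-- The label of the second kernel coefficient. -/
def kerB (p : ℤˣ) (l : ℕ) : Label := ⟨0, ∅, l - 1, 1, if p = 1 then 1 else 0, by simp, by simp⟩

/-- A letter of mode number at most `-2` uses up at least 2 of the level and has weight 0. Hence `n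
+ r₁ ≤ level - 2`, and the weight `2n + r₁ + r₂` is at most `2(level - 2) + 1`. -/
lemma kernel_or (X : Label) : X = kerA X.parity X.level ∨
    (X.level ≠ 0 ∧ X = kerB X.parity X.level) ∨
      ((∃ x ∈ X.word, x.idx ≤ -2) ∧ (X.word.map Mode.wt).sum ≤ 2 * X.level - 3) := by
  by_cases hL : X.Ls = 0
  · by_cases hG : X.Gs = ∅
    · obtain ⟨Ls, Gs, n, r₁, r₂, h1, h2⟩ := X
      simp only at hL hG
      subst hL hG
      fin_cases r₁ <;> fin_cases r₂ <;> simp [kerA, kerB, level, parity]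
    · obtain ⟨m, hm⟩ := Finset.nonempty_iff_ne_empty.mpr hG
      have h2 := X.two_le_G m hm
      refine Or.inr (Or.inr ⟨⟨_, mem_word.mpr (Or.inr (Or.inl ⟨m, hm, rfl⟩)), ?_⟩, ?_⟩)
      · simp only [Mode.idx]; omega
      · have := Finset.single_le_sum (f := fun m => m) (fun _ _ => Nat.zero_le _) hm
        rw [sum_word_wt, level]
        omega
  · obtain ⟨m, hm⟩ := Multiset.exists_mem_of_ne_zero hL
    have h2 := X.two_le_L m hm
    refine Or.inr (Or.inr ⟨⟨_, mem_word.mpr (Or.inl ⟨m, hm, rfl⟩), ?_⟩, ?_⟩)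
    · simp only [Mode.idx]; omega
    · have := Multiset.single_le_sum (fun _ _ => Nat.zero_le _) m hm
      rw [sum_word_wt, level]
      omega

/-- The label with the power of `G 0` exchanged. -/
def flipG (X : Label) : Label := ⟨X.Ls, X.Gs, X.n, X.r₁, 1 - X.r₂, X.two_le_L, X.two_le_G⟩

lemma flipG_flipG (X : Label) : X.flipG.flipG = X := by simp [flipG]

lemma flipG_kerA (p : ℤˣ) (l : ℕ) : (kerA (-p) l).flipG = kerA p l := by
  rcases Int.units_eq_one_or p with rfl | rfl <;> simp [flipG, kerA]

lemma flipG_kerB (p : ℤˣ) (l : ℕ) : (kerB (-p) l).flipG = kerB p l := by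
  rcases Int.units_eq_one_or p with rfl | rfl <;> simp [flipG, kerB]

end Label

open Label

section Kernel

variable (c Δ) in
/-- The basis vector `L (-1) ^ n * G (-1) ^ r₁ * G 0 ^ r₂`. -/
def kv (n : ℕ) (r₁ r₂ : Fin 2) : (alg c Δ).Space :=
  (alg c Δ).e (equivWord c Δ ⟨0, ∅, n, r₁, r₂, by simp, by simp⟩)

lemma kv_mem (n : ℕ) (r₁ r₂ : Fin 2) {m : ℤ} (h : 2 * n + (r₁ : ℕ) + (r₂ : ℕ) ≤ m) :
    kv c Δ n r₁ r₂ ∈ (alg c Δ).lowWeight m :=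
  e_mem_lowWeight ((sum_word_wt _).trans_le h)

lemma X_e_eq {i : Mode} {X Y : Label} (h : Y.word = i :: X.word) :
    (alg c Δ).X i ((alg c Δ).e (equivWord c Δ X)) = (alg c Δ).e (equivWord c Δ Y) := by
  have hf : (alg c Δ).Fits i (equivWord c Δ X).1 := by
    have := Y.std_word (c := c) (Δ := Δ)
    rw [h] at this
    exact this.1
  rw [X_of_fits _ _ _ hf]
  congr 1
  exact Subtype.ext h.symm

lemma X_L_kv (n : ℕ) (r₁ r₂ : Fin 2) : (alg c Δ).X (.L (-1)) (kv c Δ n r₁ r₂) =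
    kv c Δ (n + 1) r₁ r₂ :=
  X_e_eq (by simp [word, List.replicate_succ])

lemma X_G_kv (r₂ : Fin 2) : (alg c Δ).X (.G (-1)) (kv c Δ 0 0 r₂) = kv c Δ 0 1 r₂ :=
  X_e_eq (by simp [word])

lemma X_G₀_kv_zero : (alg c Δ).X (.G 0) (kv c Δ 0 0 0) = kv c Δ 0 0 1 :=
  X_e_eq (by simp [word])

lemma kv_zero : kv c Δ 0 0 0 = (alg c Δ).e (alg c Δ).nil := by
  refine congrArg (alg c Δ).e (Subtype.ext ?_)
  simp [equivWord_coe, word, nil]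

lemma X_G₀_kv_one : (alg c Δ).X (.G 0) (kv c Δ 0 0 1) = (Δ - c / 24) • kv c Δ 0 0 0 := by
  have h := X_comm (D := alg c Δ) (.G 0) (.G 0) (kv c Δ 0 0 0)
  have h0 : (alg c Δ).X (.L 0) (kv c Δ 0 0 0) = Δ • kv c Δ 0 0 0 := by
    rw [kv_zero, X_nil _ _ (by simp [Mode.neg])]
    simp [Mode.lam]
  rw [X_G₀_kv_zero] at h
  simp only [alg_ε, alg_f, alg_ω, Mode.ε, Mode.f, Mode.ω, Mode.G_add_G, add_zero, if_true, h0,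
    Int.cast_zero] at h
  have h2 : (2 : ℂ) • (alg c Δ).X (.G 0) (kv c Δ 0 0 1) =
      (2 : ℂ) • (Δ - c / 24) • kv c Δ 0 0 0 := by
    rw [two_smul]
    nth_rw 1 [h]
    module
  exact smul_right_injective _ two_ne_zero h2

/-- Commuting `G (-1)` past `L (-1)` produces `G (-2)`, of weight 0, and loses a factor `L (-1)`. -/
lemma X_G_kv_sub_mem (n : ℕ) (r₂ : Fin 2) :
    (alg c Δ).X (.G (-1)) (kv c Δ n 0 r₂) - kv c Δ n 1 r₂ ∈ (alg c Δ).lowWeight (2 * n - 1) := by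
  induction n with
  | zero => rw [X_G_kv, sub_self]; exact Submodule.zero_mem _
  | succ n ih =>
    have h := X_comm (D := alg c Δ) (.G (-1)) (.L (-1)) (kv c Δ n 0 r₂)
    rw [X_L_kv] at h
    rw [h, ← X_L_kv]
    have m1 : (alg c Δ).X (.L (-1)) ((alg c Δ).X (.G (-1)) (kv c Δ n 0 r₂) - kv c Δ n 1 r₂) ∈
        (alg c Δ).lowWeight (2 * (n + 1 : ℕ) - 1) :=
      X_mem_lowWeight _ ih (by simp [Mode.wt]; linarith)
    have m2 : (alg c Δ).X (.G (-1) + .L (-1)) (kv c Δ n 0 r₂) ∈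
        (alg c Δ).lowWeight (2 * (n + 1 : ℕ) - 1) :=
      X_mem_lowWeight _ (kv_mem n 0 r₂ le_rfl) (by simp [Mode.wt]; omega)
    rw [map_sub] at m1
    convert add_mem m1 (Submodule.smul_mem _ (Mode.f (.G (-1)) (.L (-1))) m2) using 1
    simp only [alg_ε, alg_f, alg_ω, Mode.ε, Mode.ω]
    module

/-- The square `G(-1)² = L(-2)` has weight 0, which improves on the bound given by adding weights.
-/
lemma X_G_kv_mem (n : ℕ) (r₂ : Fin 2) :
    (alg c Δ).X (.G (-1)) (kv c Δ n 1 r₂) ∈ (alg c Δ).lowWeight (2 * n + 1) := by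
  induction n with
  | zero =>
    have h := X_comm (D := alg c Δ) (.G (-1)) (.G (-1)) (kv c Δ 0 0 r₂)
    rw [X_G_kv] at h
    have h2 : (alg c Δ).X (.G (-1)) (kv c Δ 0 1 r₂) =
        (alg c Δ).X (.G (-1) + .G (-1)) (kv c Δ 0 0 r₂) := by
      have h3 : (2 : ℂ) • (alg c Δ).X (.G (-1)) (kv c Δ 0 1 r₂) =
          (2 : ℂ) • (alg c Δ).X (.G (-1) + .G (-1)) (kv c Δ 0 0 r₂) := by
        rw [two_smul]
        nth_rw 1 [h]
        simp only [alg_ε, alg_f, alg_ω, Mode.ε, Mode.f, Mode.ω]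
        norm_num
      exact smul_right_injective _ two_ne_zero h3
    rw [h2]
    exact X_mem_lowWeight _ (kv_mem 0 0 r₂ le_rfl) (by simp [Mode.wt]; omega)
  | succ n ih =>
    have h := X_comm (D := alg c Δ) (.G (-1)) (.L (-1)) (kv c Δ n 1 r₂)
    rw [X_L_kv] at h
    rw [h]
    refine add_mem (add_mem (Submodule.smul_mem _ _ ?_) (Submodule.smul_mem _ _ ?_)) ?_
    · exact X_mem_lowWeight _ ih (by simp [Mode.wt]; linarith)
    · exact X_mem_lowWeight _ (kv_mem n 1 r₂ le_rfl) (by simp [Mode.wt]; omega)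
    · simp [Mode.ω]

/-- Each commutation of `G 0` past `L (-1)` gives `½ G (-1)`, in total `n/2` times `L(-1)^(n-1)
G(-1)`. The sequence `z` stands for `L(-1)^n` applied to `G 0` on the rest, so that both values of
`r₂` are covered. -/
lemma X_G₀_kv_sub_mem {r₂ : Fin 2} {z : ℕ → (alg c Δ).Space}
    (h0 : (alg c Δ).X (.G 0) (kv c Δ 0 0 r₂) = z 0)
    (hs : ∀ n, (alg c Δ).X (.L (-1)) (z n) = z (n + 1)) (n : ℕ) :
    (alg c Δ).X (.G 0) (kv c Δ n 0 r₂) - (z n + ((n : ℂ) / 2) • kv c Δ (n - 1) 1 r₂) ∈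
      (alg c Δ).lowWeight (2 * n - 2) := by
  induction n with
  | zero => simp [h0]
  | succ n ih =>
    have h := X_comm (D := alg c Δ) (.G 0) (.L (-1)) (kv c Δ n 0 r₂)
    rw [X_L_kv] at h
    have m1 := X_mem_lowWeight (D := alg c Δ) (.L (-1)) ih (n := 2 * (n + 1 : ℕ) - 2)
      (by simp [Mode.wt]; linarith)
    have m2 := lowWeight_mono (n := 2 * (n + 1 : ℕ) - 2) (by push_cast; linarith)
      (X_G_kv_sub_mem (c := c) (Δ := Δ) n r₂)
    -- For `n = 0` the truncated `n - 1` gives a wrong monomial, but its coefficient is zero.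
    have h3 : (n : ℂ) • (alg c Δ).X (.L (-1)) (kv c Δ (n - 1) 1 r₂) = (n : ℂ) • kv c Δ n 1 r₂ := by
      rcases n with _ | n
      · simp
      · rw [X_L_kv, Nat.add_sub_cancel]
    have h4 : ((n : ℂ) / 2) • (alg c Δ).X (.L (-1)) (kv c Δ (n - 1) 1 r₂) =
        ((n : ℂ) / 2) • kv c Δ n 1 r₂ := by
      rw [div_eq_inv_mul, mul_smul, mul_smul, h3]
    rw [map_sub, map_add, map_smul, h4, hs] at m1
    convert add_mem m1 (Submodule.smul_mem _ (1 / 2 : ℂ) m2) using 1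
    rw [h]
    simp only [alg_ε, alg_f, alg_ω, Mode.ε, Mode.f, Mode.ω, Mode.G_add_L, Nat.add_sub_cancel]
    push_cast
    module

/-- The commutators of `G 0` with `L (-1)` now create a second `G (-1)`, and these terms are low by
`X_G_kv_mem`; only `z` remains. -/
lemma X_G₀_kv_one_sub_mem {r₂ : Fin 2} {z : ℕ → (alg c Δ).Space}
    (h0 : (alg c Δ).X (.G 0) (kv c Δ 0 1 r₂) = z 0)
    (hs : ∀ n, (alg c Δ).X (.L (-1)) (z n) = z (n + 1)) (n : ℕ) :
    (alg c Δ).X (.G 0) (kv c Δ n 1 r₂) - z n ∈ (alg c Δ).lowWeight (2 * n) := by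
  induction n with
  | zero => simp [h0]
  | succ n ih =>
    have h := X_comm (D := alg c Δ) (.G 0) (.L (-1)) (kv c Δ n 1 r₂)
    rw [X_L_kv] at h
    have m1 := X_mem_lowWeight (D := alg c Δ) (.L (-1)) ih (n := 2 * (n + 1 : ℕ))
      (by simp [Mode.wt]; linarith)
    have m2 := lowWeight_mono (n := 2 * (n + 1 : ℕ)) (by push_cast; linarith)
      (X_G_kv_mem (c := c) (Δ := Δ) n r₂)
    rw [map_sub, hs] at m1
    convert add_mem m1 (Submodule.smul_mem _ (1 / 2 : ℂ) m2) using 1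
    rw [h]
    simp only [alg_ε, alg_f, alg_ω, Mode.ε, Mode.f, Mode.ω, Mode.G_add_L]
    push_cast
    module

lemma X_G₀_kv_zero_one (r₂ : Fin 2) : (alg c Δ).X (.G 0) (kv c Δ 0 1 r₂) =
    -(alg c Δ).X (.G (-1)) ((alg c Δ).X (.G 0) (kv c Δ 0 0 r₂)) + (2 : ℂ) • kv c Δ 1 0 r₂ := by
  have h := X_comm (D := alg c Δ) (.G 0) (.G (-1)) (kv c Δ 0 0 r₂)
  rw [X_G_kv] at h
  rw [h]
  simp only [alg_ε, alg_f, alg_ω, Mode.ε, Mode.f, Mode.ω, Mode.G_add_G, zero_add, X_L_kv]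
  norm_num

/-- `G 0` on `a L(-1)^l + b L(-1)^(l-1) G(-1) G(0)`, up to lower weight. -/
lemma X_G₀_even_mem (l : ℕ) (a b : ℂ) (hb : l = 0 → b = 0) :
    (alg c Δ).X (.G 0) (a • kv c Δ l 0 0 + b • kv c Δ (l - 1) 1 1) -
      ((a + 2 * b) • kv c Δ l 0 1 + (-b * (Δ - c / 24) + l * a / 2) • kv c Δ (l - 1) 1 0) ∈
      (alg c Δ).lowWeight (2 * l - 2) := by
  have m1 := X_G₀_kv_sub_mem (c := c) (Δ := Δ) (r₂ := 0) (z := fun n => kv c Δ n 0 1)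
    X_G₀_kv_zero (fun n => X_L_kv n 0 1) l
  rcases l with _ | l
  · rw [hb rfl]
    convert Submodule.smul_mem _ a m1 using 1
    rw [map_add, map_smul, map_smul]
    push_cast
    module
  have m2 := X_G₀_kv_one_sub_mem (c := c) (Δ := Δ) (r₂ := 1)
    (z := fun n => -(Δ - c / 24) • kv c Δ n 1 0 + (2 : ℂ) • kv c Δ (n + 1) 0 1)
    (by rw [X_G₀_kv_zero_one, X_G₀_kv_one, map_smul, X_G_kv]; module)
    (fun n => by simp only [map_add, map_smul, X_L_kv]) l
  convert add_mem (Submodule.smul_mem _ a m1)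
    (Submodule.smul_mem _ b (lowWeight_mono (by push_cast; linarith) m2)) using 1
  rw [map_add, map_smul, map_smul, Nat.add_sub_cancel]
  module

/-- `G 0` on `a L(-1)^l G(0) + b L(-1)^(l-1) G(-1)`, up to lower weight. -/
lemma X_G₀_odd_mem (l : ℕ) (a b : ℂ) (hb : l = 0 → b = 0) :
    (alg c Δ).X (.G 0) (a • kv c Δ l 0 1 + b • kv c Δ (l - 1) 1 0) -
      ((a * (Δ - c / 24) + 2 * b) • kv c Δ l 0 0 + (l * a / 2 - b) • kv c Δ (l - 1) 1 1) ∈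
      (alg c Δ).lowWeight (2 * l - 2) := by
  have m1 := X_G₀_kv_sub_mem (c := c) (Δ := Δ) (r₂ := 1)
    (z := fun n => (Δ - c / 24) • kv c Δ n 0 0)
    X_G₀_kv_one (fun n => by simp only [map_smul, X_L_kv]) l
  rcases l with _ | l
  · rw [hb rfl]
    convert Submodule.smul_mem _ a m1 using 1
    rw [map_add, map_smul, map_smul]
    push_cast
    module
  have m2 := X_G₀_kv_one_sub_mem (c := c) (Δ := Δ) (r₂ := 0)
    (z := fun n => -kv c Δ n 1 1 + (2 : ℂ) • kv c Δ (n + 1) 0 0)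
    (by rw [X_G₀_kv_zero_one, X_G₀_kv_zero, X_G_kv])
    (fun n => by simp only [map_add, map_neg, map_smul, X_L_kv]) l
  convert add_mem (Submodule.smul_mem _ a m1)
    (Submodule.smul_mem _ b (lowWeight_mono (by push_cast; linarith) m2)) using 1
  rw [map_add, map_smul, map_smul, Nat.add_sub_cancel]
  module

end Kernel

end Ramond
end

/-! ### Highest weight vectors, their normal forms, and multiplication by `G 0` on either side. -/

noncomputable section

set_option linter.unusedSimpArgs false
set_option linter.unusedSectionVars false

namespace Ramond

open Finsupp ColorLie Label

variable {c Δ : ℂ} {V : Type} [AddCommGroup V] [Module ℂ V] [Module U V] [IsScalarTower ℂ U V]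
  {v₀ : V}

lemma coeffA_eq (p : ℤˣ) (l : ℕ) (κ : Label →₀ ℂ) : coeffA p l κ = κ (kerA p l) := rfl

lemma coeffB_eq (p : ℤˣ) (l : ℕ) (κ : Label →₀ ℂ) :
    coeffB p l κ = if l = 0 then 0 else κ (kerB p l) := rfl

lemma op_add (κ μ : Label →₀ ℂ) : op (κ + μ) = op κ + op μ :=
  Finsupp.sum_add_index' (h := fun (X : Label) (a : ℂ) => a • X.mono)
    (fun _ => zero_smul ℂ _) (fun _ _ _ => add_smul _ _ _)

lemma op_single (X : Label) (a : ℂ) : op (single X a) = a • X.mono :=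
  Finsupp.sum_single_index (h := fun (X : Label) (a : ℂ) => a • X.mono) (zero_smul ℂ _)

variable (c Δ) in
/-- Combinations of labels are combinations of standard words. -/
def labelSpace : (Label →₀ ℂ) ≃ₗ[ℂ] (alg c Δ).Space := Finsupp.domLCongr (equivWord c Δ)

lemma labelSpace_single (X : Label) (a : ℂ) :
    labelSpace c Δ (single X a) = single (equivWord c Δ X) a :=
  Finsupp.domLCongr_single _ _ _

@[simp] lemma labelSpace_apply (κ : Label →₀ ℂ) (X : Label) :
    labelSpace c Δ κ (equivWord c Δ X) = κ X := by
  simp [labelSpace]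

/-- The highest weight conditions in a module over the enveloping algebra. -/
def IsHW (c Δ : ℂ) (p : ℤˣ) (l : ℕ) (Ψ : V) : Prop :=
  L 0 • Ψ = (Δ + l) • Ψ ∧ C • Ψ = c • Ψ ∧ F • Ψ = (((p : ℤˣ) : ℤ) : ℂ) • Ψ ∧
    ∀ m : ℤ, 1 ≤ m → L m • Ψ = 0 ∧ G m • Ψ = 0

namespace IsVerma

variable (H : IsVerma c Δ v₀)
include H

/-- The Verma module is isomorphic to the space of standard words. -/
def spaceEquiv : (alg c Δ).Space ≃ₗ[ℂ] V :=
  LinearEquiv.ofBijective (toVerma c Δ v₀) ⟨H.toVerma_injective, H.toVerma_surjective⟩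

lemma spaceEquiv_X (i : Mode) (x : (alg c Δ).Space) :
    H.spaceEquiv ((alg c Δ).X i x) = i.op • H.spaceEquiv x :=
  H.toVerma_X i x

/-- The standard monomials form a basis of the Verma module. -/
def labelEquiv : (Label →₀ ℂ) ≃ₗ[ℂ] V :=
  (labelSpace c Δ).trans H.spaceEquiv

lemma labelEquiv_single (X : Label) (a : ℂ) : H.labelEquiv (single X a) = a • X.mono • v₀ := by
  rw [← mul_one a, ← smul_eq_mul, ← smul_single, map_smul, smul_eq_mul, mul_one, labelEquiv,
    LinearEquiv.trans_apply, labelSpace_single, mono_eq]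
  congr 1
  exact toVerma_e _

lemma labelEquiv_apply (κ : Label →₀ ℂ) : H.labelEquiv κ = op κ • v₀ := by
  induction κ using Finsupp.induction_linear with
  | zero => simp [op]
  | add κ μ h h' =>
    rw [map_add, h, h', ← add_smul, op_add]
  | single X a =>
    rw [labelEquiv_single, op_single, smul_assoc]

/-- A vector whose image under an operator diagonal on monomials is a multiple of it is
supported on the corresponding eigenspace. -/
lemma eq_of_mem_support {T : V →ₗ[ℂ] V} {t : Label → ℂ} {a : ℂ} {κ : Label →₀ ℂ}
    (hT : ∀ X : Label, T (X.mono • v₀) = t X • X.mono • v₀)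
    (hκ : T (H.labelEquiv κ) = a • H.labelEquiv κ) {X : Label} (hX : X ∈ κ.support) :
    t X = a := by
  have key : ∀ μ : Label →₀ ℂ, H.labelEquiv.symm (T (H.labelEquiv μ)) X = t X * μ X := by
    intro μ
    induction μ using Finsupp.induction_linear with
    | zero => simp
    | add μ ν h h' => simp only [map_add, Finsupp.add_apply, h, h', mul_add]
    | single Y b =>
      rw [H.labelEquiv_single, map_smul, hT, smul_comm, ← H.labelEquiv_single, map_smul,
        LinearEquiv.symm_apply_apply, Finsupp.smul_apply, smul_eq_mul]
      by_cases h : Y = X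
      · rw [h]
      · rw [single_eq_of_ne' h, mul_zero, mul_zero]
  have h := key κ
  rw [hκ, map_smul, LinearEquiv.symm_apply_apply, Finsupp.smul_apply, smul_eq_mul] at h
  exact (mul_right_cancel₀ (mem_support_iff.mp hX) h).symm

lemma L₀_smul_word (w : List Mode) : L 0 • (w.map Mode.op).prod • v₀ =
    (Δ - ((w.map Mode.idx).sum : ℤ)) • (w.map Mode.op).prod • v₀ := by
  induction w with
  | nil =>
    have := H.op_smul_vac (.L 0) (by simp [Mode.neg])
    simpa [Mode.lam, Mode.op] using this
  | cons i w ih =>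
    simp only [List.map_cons, List.prod_cons, mul_smul, List.sum_cons]
    have h := H.op_op_smul (.L 0) i ((w.map Mode.op).prod • v₀)
    have hε : Mode.ε (.L 0) i = 1 := by cases i <;> rfl
    have hf : Mode.f (.L 0) i = -i.idx := by cases i <;> simp [Mode.f, Mode.idx]
    have hω : Mode.ω c (.L 0) i = 0 := by cases i <;> simp [Mode.ω]
    have hi : .L 0 + i = i := by cases i <;> simp
    rw [show (Mode.L 0).op = L 0 from rfl, ih, hε, hf, hω, hi, one_smul, zero_smul, add_zero,
      smul_comm i.op (Δ - ((w.map Mode.idx).sum : ℤ) : ℂ), ← add_smul] at h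
    rw [h]
    congr 1
    push_cast
    ring

lemma L₀_smul_mono (X : Label) : L 0 • X.mono • v₀ = (Δ + X.level) • X.mono • v₀ := by
  rw [mono_eq, H.L₀_smul_word, sum_word_idx]
  push_cast
  rw [sub_neg_eq_add]

lemma F_smul_mono (X : Label) : F • X.mono • v₀ =
    (((X.parity : ℤˣ) : ℤ) : ℂ) • X.mono • v₀ := by
  rw [mono_eq, H.F_smul_word, prod_word_sgn]

/-- Monomials are eigenvectors of `L 0` and `F`, and the eigenvalues `Δ + level` and the parity sign
determine level and parity. -/
lemma mem_support_of_isHW {p : ℤˣ} {l : ℕ} {κ : Label →₀ ℂ} (h : IsHW c Δ p l (H.labelEquiv κ))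
    {X : Label} (hX : X ∈ κ.support) : X.level = l ∧ X.parity = p := by
  constructor
  · have := H.eq_of_mem_support (T := Algebra.lsmul ℂ ℂ V (L 0)) H.L₀_smul_mono h.1 hX
    exact_mod_cast add_left_cancel this
  · have := H.eq_of_mem_support (T := Algebra.lsmul ℂ ℂ V F) H.F_smul_mono h.2.2.1 hX
    exact Units.ext (by exact_mod_cast this)

lemma op_smul_of_isHW {p : ℤˣ} {l : ℕ} {Ψ : V} (h : IsHW c Δ p l Ψ) {i : Mode} (hi : 1 ≤ i.idx) :
    i.op • Ψ = 0 := by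
  cases i with
  | L m => exact (h.2.2.2 m hi).1
  | G m => exact (h.2.2.2 m hi).2

/-- A vector satisfying the highest weight conditions is determined by its kernel coefficients. -/
theorem eq_zero_of_coeff {p : ℤˣ} {l : ℕ} {κ : Label →₀ ℂ} (h : IsHW c Δ p l (H.labelEquiv κ))
    (hA : coeffA p l κ = 0) (hB : coeffB p l κ = 0) : H.labelEquiv κ = 0 := by
  have h0 : labelSpace c Δ κ = 0 := by
    refine eq_zero_of_raising (fun i hi => H.spaceEquiv.injective ?_) fun w hw => ?_
    · rw [spaceEquiv_X, map_zero]
      exact H.op_smul_of_isHW h hi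
    · obtain ⟨X, rfl⟩ := (equivWord c Δ).surjective w
      have hX : X ∈ κ.support := by simpa using hw
      obtain ⟨rfl, rfl⟩ := H.mem_support_of_isHW h hX
      rcases X.kernel_or with h1 | ⟨h1, h2⟩ | ⟨h1, -⟩
      · rw [coeffA_eq, ← h1] at hA
        exact absurd hA (mem_support_iff.mp hX)
      · rw [coeffB_eq, if_neg h1, ← h2] at hB
        exact absurd hB (mem_support_iff.mp hX)
      · exact h1
  rw [labelEquiv, LinearEquiv.trans_apply, h0, map_zero]

lemma isHW_G₀_smul {p : ℤˣ} {l : ℕ} {Ψ : V} (h : IsHW c Δ p l Ψ) :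
    IsHW c Δ (-p) l (G 0 • Ψ) := by
  refine ⟨?_, H.C_smul _, ?_, fun m hm => ⟨?_, ?_⟩⟩
  · have := H.op_op_smul (.L 0) (.G 0) Ψ
    simp only [Mode.op, Mode.ε, Mode.f, Mode.ω] at this
    rw [this, h.1, smul_comm (G 0)]
    simp
  · have := F_op_smul (.G 0) Ψ
    simp only [Mode.op, Mode.sgn] at this
    rw [this, h.2.2.1, smul_comm (G 0), smul_smul]
    simp
  · have := H.op_op_smul (.L m) (.G 0) Ψ
    simp only [Mode.op, Mode.ε, Mode.f, Mode.ω, Mode.L_add_G, add_zero, (h.2.2.2 m hm).1,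
      (h.2.2.2 m hm).2, smul_zero, zero_smul] at this
    exact this
  · have := H.op_op_smul (.G m) (.G 0) Ψ
    simp only [Mode.op, Mode.ε, Mode.f, Mode.ω, Mode.G_add_G, add_zero, (h.2.2.2 m hm).1,
      (h.2.2.2 m hm).2, smul_zero, zero_smul, if_neg (show m ≠ 0 by omega), zero_mul] at this
    exact this

lemma G₀_G₀_smul (Ψ : V) : G 0 • G 0 • Ψ = L 0 • Ψ - (c / 24) • Ψ := by
  have := H.op_op_smul (.G 0) (.G 0) Ψ
  simp only [Mode.op, Mode.ε, Mode.f, Mode.ω, Mode.G_add_G, add_zero, if_true, Int.cast_zero]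
    at this
  have h2 : (2 : ℂ) • G 0 • G 0 • Ψ = (2 : ℂ) • (L 0 • Ψ - (c / 24) • Ψ) := by
    rw [two_smul]
    nth_rw 1 [this]
    generalize G 0 • G 0 • Ψ = y, L 0 • Ψ = x
    module
  exact smul_right_injective _ two_ne_zero h2

lemma G₀_G₀_smul_vac : G 0 • G 0 • v₀ = (Δ - c / 24) • v₀ := by
  have := H.op_smul_vac (.L 0) (by simp [Mode.neg])
  simp only [Mode.op, Mode.lam, if_true] at this
  rw [H.G₀_G₀_smul, this, sub_smul]

end IsVerma

lemma neg_mul_sub_eq_zero {R : Type} [Ring R] {a b : R} (h : a * b - b * a = 0) :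
    -a * b - b * -a = 0 := by
  rw [neg_mul, mul_neg, sub_neg_eq_add, neg_add_eq_sub, ← neg_sub, h, neg_zero]

lemma neg_mul_add_eq_zero {R : Type} [Ring R] {a b : R} (h : a * b + b * a = 0) :
    -a * b + b * -a = 0 := by
  rw [neg_mul, mul_neg, ← neg_add, h, neg_zero]

/-- The automorphism of the enveloping algebra that changes the sign of `(-1)^F`. -/
def twist : U →ₐ[ℂ] U :=
  RingQuot.liftAlgHom ℂ ⟨FreeAlgebra.lift ℂ fun x : Gen => match x with
    | .F => -F
    | x => RingQuot.mkAlgHom ℂ Rel (gen x), fun x y h => by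
      have h' := RingQuot.mkAlgHom_rel ℂ h
      cases h <;>
        simp only [map_sub, map_add, map_mul, map_smul, map_zero, gen, FreeAlgebra.lift_ι_apply,
          F] at h' ⊢ <;>
        first
          | exact h'
          | exact neg_mul_sub_eq_zero h'
          | exact neg_mul_add_eq_zero h'⟩

lemma twist_gen (x : Gen) : twist (RingQuot.mkAlgHom ℂ Rel (gen x)) = match x with
    | .F => -F
    | x => RingQuot.mkAlgHom ℂ Rel (gen x) := by
  rw [twist, RingQuot.liftAlgHom_mkAlgHom_apply, FreeAlgebra.lift_ι_apply]

lemma twist_op (i : Mode) : twist i.op = i.op := by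
  cases i <;> exact twist_gen _

lemma twist_mono (X : Label) : twist X.mono = X.mono := by
  rw [mono_eq, map_list_prod, List.map_map]
  congr 1
  exact List.map_congr_left fun i _ => twist_op i

lemma twist_op_finsupp (κ : Label →₀ ℂ) : twist (op κ) = op κ := by
  induction κ using Finsupp.induction_linear with
  | zero => simp [op]
  | add κ μ h h' => rw [op_add, map_add, h, h']
  | single X a => rw [op_single, map_smul, twist_mono]

namespace IsVerma

variable (H : IsVerma c Δ v₀)
include H

/-- The vector `G_0|Δ⟩` satisfies the generating equations of `vermaIdeal` apart from the sign of
`F`, which `twist` compensates. So equations for `u|Δ⟩` pass to `G_0|Δ⟩`. -/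
lemma twist_smul_G₀ {u : U} (hu : u • v₀ = 0) : twist u • G 0 • v₀ = 0 := by
  rw [H.smul_eq_zero] at hu
  have h0 : IsHW c Δ 1 0 v₀ := by
    refine ⟨?_, H.C_smul _, ?_, fun m hm => ⟨?_, ?_⟩⟩
    · simpa [Mode.op, Mode.lam] using H.op_smul_vac (.L 0) (by simp [Mode.neg])
    · simpa using H.F_smul_vac
    · simpa [Mode.op, Mode.lam, show m ≠ 0 by omega] using
        H.op_smul_vac (.L m) (by simp [Mode.neg]; omega)
    · simpa [Mode.op, Mode.lam] using H.op_smul_vac (.G m) (by simp [Mode.neg]; omega)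
  obtain ⟨h1, h2, h3, h4⟩ := H.isHW_G₀_smul h0
  induction hu using Submodule.span_induction with
  | mem x hx =>
    rcases hx with ⟨m, hm, rfl | rfl⟩ | rfl | rfl | rfl
    · rw [show L m = (Mode.L m).op from rfl, twist_op]
      exact (h4 m hm).1
    · rw [show G m = (Mode.G m).op from rfl, twist_op]
      exact (h4 m hm).2
    · rw [map_sub, show L 0 = (Mode.L 0).op from rfl, twist_op, AlgHom.commutes, sub_smul,
        algebraMap_smul]
      simpa [sub_eq_zero, Mode.op] using h1
    · rw [map_sub, show twist C = C from twist_gen _, AlgHom.commutes, sub_smul,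
        algebraMap_smul, h2, sub_self]
    · rw [map_sub, show twist F = -F from twist_gen _, map_one, sub_smul, neg_smul, h3]
      simp
  | zero => simp
  | add x y _ _ hx hy => rw [map_add, add_smul, hx, hy, add_zero]
  | smul a x _ hx => rw [smul_eq_mul, map_mul, mul_smul, hx, smul_zero]

/-- Each highest weight condition says that some element times `θ` annihilates `|Δ⟩`. Applying
`twist`, which fixes `θ`, moves it to `G_0|Δ⟩` and reverses only the parity. -/
lemma isHW_op_smul_G₀ {p : ℤˣ} {l : ℕ} {κ : Label →₀ ℂ} (h : IsHW c Δ p l (op κ • v₀)) :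
    IsHW c Δ (-p) l (op κ • G 0 • v₀) := by
  refine ⟨?_, H.C_smul _, ?_, fun m hm => ⟨?_, ?_⟩⟩
  · have h1 := H.twist_smul_G₀ (u := (L 0 - algebraMap ℂ U (Δ + l)) * op κ) (by
      rw [mul_smul, sub_smul, algebraMap_smul, h.1, sub_self])
    rw [map_mul, twist_op_finsupp, map_sub, show L 0 = (Mode.L 0).op from rfl, twist_op,
      AlgHom.commutes, mul_smul, sub_smul, algebraMap_smul, sub_eq_zero] at h1
    exact h1
  · have h1 := H.twist_smul_G₀ (u := (F - algebraMap ℂ U (((p : ℤˣ) : ℤ) : ℂ)) * op κ) (by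
      rw [mul_smul, sub_smul, algebraMap_smul, h.2.2.1, sub_self])
    rw [map_mul, twist_op_finsupp, map_sub, show twist F = -F from twist_gen _,
      AlgHom.commutes, mul_smul, sub_smul, algebraMap_smul, sub_eq_zero, neg_smul,
      neg_eq_iff_eq_neg] at h1
    rw [h1]
    simp
  · have h1 := H.twist_smul_G₀ (u := (Mode.L m).op * op κ) (by
      rw [mul_smul]; exact (h.2.2.2 m hm).1)
    rwa [map_mul, twist_op_finsupp, twist_op, mul_smul] at h1
  · have h1 := H.twist_smul_G₀ (u := (Mode.G m).op * op κ) (by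
      rw [mul_smul]; exact (h.2.2.2 m hm).2)
    rwa [map_mul, twist_op_finsupp, twist_op, mul_smul] at h1

lemma mono_smul_G₀ (X : Label) : X.mono • G 0 • v₀ =
    (if X.r₂ = 0 then 1 else Δ - c / 24 : ℂ) • X.flipG.mono • v₀ := by
  obtain ⟨Ls, Gs, n, r₁, r₂, h1, h2⟩ := X
  fin_cases r₂
  · simp [mono, flipG, mul_smul]
  · simp [mono, flipG, mul_smul, H.G₀_G₀_smul_vac, smul_comm _ (Δ - c / 24)]

lemma symm_op_smul_G₀ (κ : Label →₀ ℂ) (X : Label) :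
    H.labelEquiv.symm (op κ • G 0 • v₀) X =
      (if X.r₂ = 0 then Δ - c / 24 else 1) * κ X.flipG := by
  induction κ using Finsupp.induction_linear with
  | zero => simp [op]
  | add κ μ h h' =>
    rw [op_add, add_smul, map_add, Finsupp.add_apply, h, h', Finsupp.add_apply, mul_add]
  | single Y a =>
    rw [op_single, smul_assoc, H.mono_smul_G₀, smul_comm,
      ← H.labelEquiv_single, map_smul, LinearEquiv.symm_apply_apply, Finsupp.smul_apply,
      smul_eq_mul]
    by_cases h : Y.flipG = X
    · subst h
      obtain ⟨Ls, Gs, n, r₁, r₂, h1, h2⟩ := Y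
      rw [flipG_flipG, single_eq_same, single_eq_same]
      fin_cases r₂ <;> simp [flipG]
    · rw [single_eq_of_ne' h, single_eq_of_ne' fun h' => h (by rw [h', flipG_flipG]), mul_zero,
        mul_zero]

/-- The kernel coefficients of `θ G_0`. -/
lemma coeff_op_smul_G₀_one (l : ℕ) (κ : Label →₀ ℂ) :
    coeffA (-1) l (H.labelEquiv.symm (op κ • G 0 • v₀)) = coeffA 1 l κ ∧
    coeffB (-1) l (H.labelEquiv.symm (op κ • G 0 • v₀)) = coeffB 1 l κ * (Δ - c / 24) := by
  simp only [coeffA_eq, coeffB_eq, H.symm_op_smul_G₀, flipG_kerA, flipG_kerB]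
  constructor
  · simp [kerA]
  · split_ifs <;> simp_all [kerB, mul_comm]

lemma coeff_op_smul_G₀_neg_one (l : ℕ) (κ : Label →₀ ℂ) :
    coeffA 1 l (H.labelEquiv.symm (op κ • G 0 • v₀)) = coeffA (-1) l κ * (Δ - c / 24) ∧
    coeffB 1 l (H.labelEquiv.symm (op κ • G 0 • v₀)) = coeffB (-1) l κ := by
  have h : (1 : ℤˣ) = -(-1) := by simp
  simp only [coeffA_eq, coeffB_eq, H.symm_op_smul_G₀]
  rw [h, flipG_kerA, flipG_kerB]
  constructor
  · simp [kerA, mul_comm]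
  · split_ifs <;> simp_all [kerB]

lemma symm_op_smul_X (i : Mode) (κ : Label →₀ ℂ) (X : Label) :
    H.labelEquiv.symm (i.op • H.labelEquiv κ) X =
      (alg c Δ).X i (labelSpace c Δ κ) (equivWord c Δ X) := by
  rw [labelEquiv, LinearEquiv.trans_apply, ← spaceEquiv_X, LinearEquiv.symm_trans_apply,
    LinearEquiv.symm_apply_apply, ← labelSpace_apply (c := c) (Δ := Δ),
    LinearEquiv.apply_symm_apply]

end IsVerma

/-- Every non-kernel monomial of level `l` has weight at most `2l - 3`. As `G 0` adds at most 1, its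
image of these has weight at most `2l - 2`, below all kernel monomials, whose weights are at least
`2l - 1`. -/
lemma sub_kernel_mem {p : ℤˣ} {l : ℕ} {κ : Label →₀ ℂ}
    (h : ∀ X ∈ κ.support, X.level = l ∧ X.parity = p) :
    labelSpace c Δ κ -
      (coeffA p l κ • (alg c Δ).e (equivWord c Δ (kerA p l)) +
        coeffB p l κ • (alg c Δ).e (equivWord c Δ (kerB p l))) ∈
      (alg c Δ).lowWeight (2 * l - 3) := by
  classical
  have hne : kerA p l ≠ kerB p l := fun h => by simp [kerA, kerB] at h
  refine (mem_supported ℂ _).mpr fun w hw => ?_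
  obtain ⟨X, rfl⟩ := (equivWord c Δ).surjective w
  have hX : κ X - (coeffA p l κ * (if kerA p l = X then 1 else 0) +
      coeffB p l κ * (if kerB p l = X then 1 else 0)) ≠ 0 := by
    have := mem_support_iff.mp hw
    simpa [single_apply] using this
  by_cases hA : kerA p l = X
  · subst hA
    simp [hne.symm, coeffA_eq] at hX
  by_cases hB : l ≠ 0 ∧ kerB p l = X
  · obtain ⟨hl, rfl⟩ := hB
    simp [hne, coeffB_eq, hl] at hX
  have hX' : X ∈ κ.support := mem_support_iff.mpr fun h0 => hX <| by
    rw [h0, if_neg hA, coeffB_eq]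
    by_cases hl : l = 0
    · simp [hl]
    · rw [if_neg fun h' => hB ⟨hl, h'⟩]; simp
  obtain ⟨rfl, rfl⟩ := h X hX'
  rcases X.kernel_or with h1 | ⟨h1, h2⟩ | ⟨-, h1⟩
  · exact absurd h1.symm hA
  · exact absurd ⟨h1, h2.symm⟩ hB
  · exact h1

lemma apply_eq_of_mem_lowWeight {n : ℤ} {x y : (alg c Δ).Space}
    (h : x - y ∈ (alg c Δ).lowWeight n) {X : Label} (hX : n < 2 * X.n + (X.r₁ : ℕ) + (X.r₂ : ℕ)) :
    x (equivWord c Δ X) = y (equivWord c Δ X) := by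
  by_contra hne
  have h1 : (alg c Δ).wtw (equivWord c Δ X) ≤ n :=
    (mem_supported ℂ _).mp h (mem_support_iff.mpr (sub_ne_zero.mpr hne))
  have h2 : (alg c Δ).wtw (equivWord c Δ X) = _ := X.sum_word_wt
  omega

lemma kv_apply (n : ℕ) (r₁ r₂ : Fin 2) (X : Label) : kv c Δ n r₁ r₂ (equivWord c Δ X) =
    if X.Ls = 0 ∧ X.Gs = ∅ ∧ X.n = n ∧ X.r₁ = r₁ ∧ X.r₂ = r₂ then 1 else 0 := by
  classical
  rw [kv, single_apply]
  simp only [EmbeddingLike.apply_eq_iff_eq, Label.ext_iff]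
  congr 1
  simp only [eq_comm]

namespace IsVerma

variable (H : IsVerma c Δ v₀)
include H

/-- The kernel coefficients of `G_0 θ` for even `θ`. -/
lemma coeff_G₀_smul_one {l : ℕ} {κ : Label →₀ ℂ}
    (h : ∀ X ∈ κ.support, X.level = l ∧ X.parity = 1) :
    coeffA (-1) l (H.labelEquiv.symm (G 0 • H.labelEquiv κ)) = coeffA 1 l κ + 2 * coeffB 1 l κ ∧
    coeffB (-1) l (H.labelEquiv.symm (G 0 • H.labelEquiv κ)) =
      -coeffB 1 l κ * (Δ - c / 24) + l * coeffA 1 l κ / 2 := by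
  have hb : l = 0 → coeffB 1 l κ = 0 := fun hl => by rw [coeffB_eq, if_pos hl]
  have h1 := X_mem_lowWeight (.G 0) (sub_kernel_mem (c := c) (Δ := Δ) h) (n := 2 * l - 2)
    (by simp [Mode.wt]; linarith)
  have h2 := X_G₀_even_mem (c := c) (Δ := Δ) l (coeffA 1 l κ) (coeffB 1 l κ) hb
  rw [map_sub] at h1
  have h3 := add_mem h1 h2
  rw [show (alg c Δ).e (equivWord c Δ (kerA 1 l)) = kv c Δ l 0 0 from rfl,
    show (alg c Δ).e (equivWord c Δ (kerB 1 l)) = kv c Δ (l - 1) 1 1 from rfl,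
    sub_add_sub_cancel] at h3
  have hX := H.symm_op_smul_X (.G 0) κ
  simp only [Mode.op] at hX
  simp only [coeffA_eq (-1), coeffB_eq (-1), hX]
  constructor
  · rw [apply_eq_of_mem_lowWeight h3 (by simp [kerA])]
    simp [kv_apply, kerA]
  · split_ifs with hl
    · subst hl; rw [hb rfl]; simp
    · rw [apply_eq_of_mem_lowWeight h3 (by simp [kerB]; omega)]
      simp [kv_apply, kerB]

/-- The kernel coefficients of `G_0 θ` for odd `θ`. -/
lemma coeff_G₀_smul_neg_one {l : ℕ} {κ : Label →₀ ℂ}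
    (h : ∀ X ∈ κ.support, X.level = l ∧ X.parity = -1) :
    coeffA 1 l (H.labelEquiv.symm (G 0 • H.labelEquiv κ)) =
      coeffA (-1) l κ * (Δ - c / 24) + 2 * coeffB (-1) l κ ∧
    coeffB 1 l (H.labelEquiv.symm (G 0 • H.labelEquiv κ)) =
      l * coeffA (-1) l κ / 2 - coeffB (-1) l κ := by
  have hb : l = 0 → coeffB (-1) l κ = 0 := fun hl => by rw [coeffB_eq, if_pos hl]
  have h1 := X_mem_lowWeight (.G 0) (sub_kernel_mem (c := c) (Δ := Δ) h) (n := 2 * l - 2)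
    (by simp [Mode.wt]; linarith)
  have h2 := X_G₀_odd_mem (c := c) (Δ := Δ) l (coeffA (-1) l κ) (coeffB (-1) l κ) hb
  rw [map_sub] at h1
  have h3 := add_mem h1 h2
  rw [show (alg c Δ).e (equivWord c Δ (kerA (-1) l)) = kv c Δ l 0 1 from rfl,
    show (alg c Δ).e (equivWord c Δ (kerB (-1) l)) = kv c Δ (l - 1) 1 0 from rfl,
    sub_add_sub_cancel] at h3
  have hX := H.symm_op_smul_X (.G 0) κ
  simp only [Mode.op] at hX
  simp only [coeffA_eq 1, coeffB_eq 1, hX]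
  constructor
  · rw [apply_eq_of_mem_lowWeight h3 (by simp [kerA])]
    simp [kv_apply, kerA]
  · split_ifs with hl
    · subst hl; rw [hb rfl]; simp
    · rw [apply_eq_of_mem_lowWeight h3 (by simp [kerB]; omega)]
      simp [kv_apply, kerB]

end IsVerma

lemma IsVerma.existsUnique_normalForm {v₀ : V} (H : IsVerma c Δ v₀) {p : ℤˣ} {l : ℕ} {Ψ : V}
    (h : IsHW c Δ p l Ψ) :
    ∃! κ : Label →₀ ℂ, (∀ X ∈ κ.support, X.level = l ∧ X.parity = p) ∧ Ψ = op κ • v₀ := by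
  refine ⟨H.labelEquiv.symm Ψ, ⟨fun X hX => H.mem_support_of_isHW
    (by rwa [LinearEquiv.apply_symm_apply]) hX, ?_⟩, fun κ hκ => ?_⟩
  · rw [← H.labelEquiv_apply, LinearEquiv.apply_symm_apply]
  · rw [LinearEquiv.eq_symm_apply, H.labelEquiv_apply, hκ.2]

/-- Follows from `G_0² = L_0 - c/24`; it fixes the level of a nonzero `G`-closed vector. -/
lemma IsVerma.smul_eq_zero_of_G₀ {v₀ : V} (H : IsVerma c Δ v₀) {p : ℤˣ} {l : ℕ} {Ψ : V}
    (h : IsHW c Δ p l Ψ) (h0 : G 0 • Ψ = 0) : (Δ + l - c / 24) • Ψ = 0 := by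
  have := H.G₀_G₀_smul Ψ
  rw [h0, smul_zero, h.1, ← sub_smul] at this
  exact this.symm

lemma IsHighestWeight.isHW {p : ℤˣ} {l : ℕ} {Ψ : Verma c Δ} (h : IsHighestWeight c Δ p l Ψ) :
    IsHW c Δ p l Ψ := h

lemma IsHighestWeight.existsUnique_isNormalForm {p : ℤˣ} {l : ℕ} {Ψ : Verma c Δ}
    (h : IsHighestWeight c Δ p l Ψ) : ∃! κ, IsNormalForm c Δ p l κ Ψ :=
  (isVerma_vac c Δ).existsUnique_normalForm h.isHW

variable (c Δ) in
/-- The coefficients of a vector of the Verma module along the standard monomials. -/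
def coeffs (Ψ : Verma c Δ) : Label →₀ ℂ := (isVerma_vac c Δ).labelEquiv.symm Ψ

lemma IsNormalForm.eq_coeffs {p : ℤˣ} {l : ℕ} {κ : Label →₀ ℂ} {Ψ : Verma c Δ}
    (h : IsNormalForm c Δ p l κ Ψ) : κ = coeffs c Δ Ψ := by
  rw [coeffs, LinearEquiv.eq_symm_apply, (isVerma_vac c Δ).labelEquiv_apply]
  exact h.2.symm

lemma IsHighestWeight.isNormalForm {p : ℤˣ} {l : ℕ} {Ψ : Verma c Δ}
    (h : IsHighestWeight c Δ p l Ψ) : IsNormalForm c Δ p l (coeffs c Δ Ψ) Ψ := by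
  obtain ⟨κ, hκ, -⟩ := h.existsUnique_isNormalForm
  rwa [← IsNormalForm.eq_coeffs hκ]

lemma isAB_iff {p : ℤˣ} {l : ℕ} {a b : ℂ} {Ψ : Verma c Δ} : IsAB c Δ p l a b Ψ ↔
    IsHighestWeight c Δ p l Ψ ∧ coeffA p l (coeffs c Δ Ψ) = a ∧ coeffB p l (coeffs c Δ Ψ) = b := by
  refine ⟨fun h => ⟨h.1, h.2.2 _ h.1.isNormalForm⟩,
    fun h => ⟨h.1, h.1.existsUnique_isNormalForm, ?_⟩⟩
  intro κ hκ
  rw [hκ.eq_coeffs]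
  exact h.2

lemma IsHighestWeight.isAB_G₀_smul {l : ℕ} {Ψ : Verma c Δ} (h : IsHighestWeight c Δ 1 l Ψ) :
    IsAB c Δ (-1) l (coeffA 1 l (coeffs c Δ Ψ) + 2 * coeffB 1 l (coeffs c Δ Ψ))
      (-coeffB 1 l (coeffs c Δ Ψ) * (Δ - c / 24) + l * coeffA 1 l (coeffs c Δ Ψ) / 2)
      (G 0 • Ψ) := by
  have h1 := (isVerma_vac c Δ).coeff_G₀_smul_one h.isNormalForm.1
  rw [coeffs, LinearEquiv.apply_symm_apply] at h1
  exact isAB_iff.mpr ⟨(isVerma_vac c Δ).isHW_G₀_smul h.isHW, h1⟩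

lemma IsHighestWeight.isAB_G₀_smul' {l : ℕ} {Ψ : Verma c Δ} (h : IsHighestWeight c Δ (-1) l Ψ) :
    IsAB c Δ 1 l
      (coeffA (-1) l (coeffs c Δ Ψ) * (Δ - c / 24) + 2 * coeffB (-1) l (coeffs c Δ Ψ))
      (l * coeffA (-1) l (coeffs c Δ Ψ) / 2 - coeffB (-1) l (coeffs c Δ Ψ))
      (G 0 • Ψ) := by
  have h1 := (isVerma_vac c Δ).coeff_G₀_smul_neg_one h.isNormalForm.1
  rw [coeffs, LinearEquiv.apply_symm_apply] at h1
  have h2 := (isVerma_vac c Δ).isHW_G₀_smul h.isHW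
  rw [neg_neg] at h2
  exact isAB_iff.mpr ⟨h2, h1⟩

lemma IsAB.eq_zero {p : ℤˣ} {l : ℕ} {Ψ : Verma c Δ} (h : IsAB c Δ p l 0 0 Ψ) : Ψ = 0 := by
  obtain ⟨h1, h2, h3⟩ := isAB_iff.mp h
  have := (isVerma_vac c Δ).eq_zero_of_coeff (κ := coeffs c Δ Ψ) (p := p) (l := l)
    (by rw [coeffs, LinearEquiv.apply_symm_apply]; exact h1) h2 h3
  rwa [coeffs, LinearEquiv.apply_symm_apply] at this

lemma isAB_zero {p : ℤˣ} {l : ℕ} {a b : ℂ} (h : IsAB c Δ p l a b 0) : a = 0 ∧ b = 0 := by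
  obtain ⟨-, rfl, rfl⟩ := isAB_iff.mp h
  have h0 : coeffs c Δ 0 = 0 := map_zero (isVerma_vac c Δ).labelEquiv.symm
  rw [h0]
  exact ⟨rfl, by rw [coeffB_eq]; split_ifs <;> rfl⟩

lemma IsSingular.ne_zero {p : ℤˣ} {l : ℕ} {Ψ : Verma c Δ} (h : IsSingular c Δ p l Ψ) : Ψ ≠ 0 :=
  fun h0 => h.2 (h0 ▸ Submodule.zero_mem _)

end Ramond
end

theorem mainTheorem4 (c Δ : ℂ) :
    -- every singular vector is given by a unique operator `θ = op κ` in normal form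
    (∀ (p : ℤˣ) (l : ℕ) (Ψ : Ramond.Verma c Δ), Ramond.IsSingular c Δ p l Ψ →
      ∃! κ : Ramond.Label →₀ ℂ, Ramond.IsNormalForm c Δ p l κ Ψ) ∧
    -- `G_0 θ|Δ⟩` and `θ G_0|Δ⟩` for `θ = (a, b)_l^+`
    (∀ (l : ℕ) (Ψ : Ramond.Verma c Δ) (κ : Ramond.Label →₀ ℂ) (a b : ℂ),
      Ramond.IsSingular c Δ 1 l Ψ → Ramond.IsNormalForm c Δ 1 l κ Ψ →
      Ramond.coeffA 1 l κ = a → Ramond.coeffB 1 l κ = b →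
      Ramond.IsAB c Δ (-1) l (a + 2 * b) (-b * (Δ - c / 24) + (l : ℂ) * a / 2)
          (Ramond.G 0 • Ramond.op κ • Ramond.vac c Δ) ∧
        Ramond.IsAB c Δ (-1) l a (b * (Δ - c / 24))
          (Ramond.op κ • Ramond.G 0 • Ramond.vac c Δ)) ∧
    -- `G_0 θ|Δ⟩` and `θ G_0|Δ⟩` for `θ = (a, b)_l^-`
    (∀ (l : ℕ) (Ψ : Ramond.Verma c Δ) (κ : Ramond.Label →₀ ℂ) (a b : ℂ),
      Ramond.IsSingular c Δ (-1) l Ψ → Ramond.IsNormalForm c Δ (-1) l κ Ψ →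
      Ramond.coeffA (-1) l κ = a → Ramond.coeffB (-1) l κ = b →
      Ramond.IsAB c Δ 1 l (a * (Δ - c / 24) + 2 * b) ((l : ℂ) * a / 2 - b)
          (Ramond.G 0 • Ramond.op κ • Ramond.vac c Δ) ∧
        Ramond.IsAB c Δ 1 l (a * (Δ - c / 24)) b
          (Ramond.op κ • Ramond.G 0 • Ramond.vac c Δ)) ∧
    -- the `G`-closed singular vectors for `Δ = c/24 - l`, `l ≠ 0`
    (∀ l : ℕ, l ≠ 0 → Δ = c / 24 - l →
      ∀ (p : ℤˣ) (l' : ℕ) (Ψ : Ramond.Verma c Δ), Ramond.IsSingular c Δ p l' Ψ →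
        (Ramond.IsGClosed Ψ ↔
          l' = l ∧
            ((p = 1 ∧ ∃ a : ℂ, Ramond.IsAB c Δ 1 l a (-a / 2) Ψ) ∨
              (p = -1 ∧ ∃ a : ℂ, Ramond.IsAB c Δ (-1) l (2 / (l : ℂ) * a) a Ψ)))) := by
  refine ⟨fun p l Ψ h => h.1.existsUnique_isNormalForm, ?_, ?_, ?_⟩
  · intro l Ψ κ a b hΨ hκ ha hb
    have h1 := hΨ.1.isAB_G₀_smul
    obtain rfl := hκ.eq_coeffs
    rw [ha, hb] at h1
    have h2 : Ψ = Ramond.op _ • Ramond.vac c Δ := hκ.2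
    rw [← h2]
    refine ⟨h1, Ramond.isAB_iff.mpr ⟨?_, ?_⟩⟩
    · exact (Ramond.isVerma_vac c Δ).isHW_op_smul_G₀ (h2 ▸ hΨ.1.isHW)
    · rw [← ha, ← hb]
      exact (Ramond.isVerma_vac c Δ).coeff_op_smul_G₀_one l _
  · intro l Ψ κ a b hΨ hκ ha hb
    have h1 := hΨ.1.isAB_G₀_smul'
    obtain rfl := hκ.eq_coeffs
    rw [ha, hb] at h1
    have h2 : Ψ = Ramond.op _ • Ramond.vac c Δ := hκ.2
    rw [← h2]
    refine ⟨h1, Ramond.isAB_iff.mpr ⟨?_, ?_⟩⟩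
    · have := (Ramond.isVerma_vac c Δ).isHW_op_smul_G₀ (h2 ▸ hΨ.1.isHW)
      rw [neg_neg] at this
      exact this
    · rw [← ha, ← hb]
      exact (Ramond.isVerma_vac c Δ).coeff_op_smul_G₀_neg_one l _
  · intro l hl hΔ p l' Ψ hΨ
    have hΔ' : Δ - c / 24 = -l := by rw [hΔ]; ring
    have hl' : (l : ℂ) ≠ 0 := Nat.cast_ne_zero.mpr hl
    have hlevel : Ramond.IsGClosed Ψ → l' = l := fun h => by
      have h1 := (smul_eq_zero.mp
        ((Ramond.isVerma_vac c Δ).smul_eq_zero_of_G₀ hΨ.1.isHW h)).resolve_right hΨ.ne_zero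
      have h2 : (l' : ℂ) = l := by linear_combination h1 - hΔ'
      exact_mod_cast h2
    constructor
    · intro h
      obtain rfl := hlevel h
      refine ⟨rfl, ?_⟩
      rcases Int.units_eq_one_or p with rfl | rfl
      · have h1 := hΨ.1.isAB_G₀_smul
        rw [show Ramond.G 0 • Ψ = 0 from h] at h1
        -- The first coefficient `a + 2b` alone gives `b = -a/2`; the other equation is a multiple
        -- of it.
        obtain ⟨h2, -⟩ := Ramond.isAB_zero h1
        refine Or.inl ⟨rfl, _, Ramond.isAB_iff.mpr ⟨hΨ.1, rfl, ?_⟩⟩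
        linear_combination h2 / 2
      · have h1 := hΨ.1.isAB_G₀_smul'
        rw [show Ramond.G 0 • Ψ = 0 from h] at h1
        obtain ⟨-, h2⟩ := Ramond.isAB_zero h1
        -- The parameter is the second kernel coefficient, and `l a'/2 - b = 0` gives the first one
        -- as `a' = 2b/l`.
        refine Or.inr ⟨rfl, _, Ramond.isAB_iff.mpr ⟨hΨ.1, ?_, rfl⟩⟩
        field_simp
        linear_combination 2 * h2
    · rintro ⟨rfl, ⟨rfl, a, h⟩ | ⟨rfl, a, h⟩⟩
      · obtain ⟨h1, h2, h3⟩ := Ramond.isAB_iff.mp h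
        have h4 := h1.isAB_G₀_smul
        rw [h2, h3, hΔ'] at h4
        -- With `Δ - c/24 = -l'` both kernel coefficients of `G_0 Ψ` vanish, and a highest weight
        -- vector with zero coefficients is zero.
        refine Ramond.IsAB.eq_zero (p := -1) (l := l') ?_
        convert h4 using 1
        · ring
        · ring
      · obtain ⟨h1, h2, h3⟩ := Ramond.isAB_iff.mp h
        have h4 := h1.isAB_G₀_smul'
        rw [h2, h3, hΔ'] at h4
        refine Ramond.IsAB.eq_zero (p := 1) (l := l') ?_
        convert h4 using 1
        · field_simp; ring
        · field_simp; ring
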